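/- Let $q$ be a prime power, let $d\ge 1$ and $n\ge 2d$ be integers, and let $J_q(n,d)$ be the Grassmann graph: its vertices are the $d$-dimensional subspaces of an $n$-dimensional vector space over $\mathbb F_q$, and two vertices are adjacent when their intersection has dimension $d-1$. Let $S$ be the set of the cliques $\{W : U\subset W\}$, where $U$ runs over the $(d-1)$-dimensional subspaces and $W$ over the vertices. A Steiner $\mathrm T_q(d-1,d,n)$ bitrade is a pair $(T_0,T_1)$ of disjoint nonempty sets of vertices of $J_q(n,d)$ such that every clique from $S$ either intersects each of $T_0$, $T_1$ in exactly one vertex or intersects neither; its cardinality is $|T_0\cup T_1|$. Write ${a\brack b}_q=\prod_{i=0}^{b-1}\frac{q^{a-i}-1}{q^{i+1}-1}$. (1) The minimum cardinality of a Steiner $\mathrm T_q(d-1,d,n)$ bitrade is $$\prod_{i=1}^{d}\left(q^{d-i}+1\right)=\sum_{i=0}^{d}q^{\binom i2}{d\brack i}_q .$$ (2) This number is the value of the weight-distribution bound. That is, $J_q(n,d)$ is distance-regular, with some diameter $D$ and intersection numbers $a_i,b_i,c_i$. It is regular of some degree $k$, all cliques from $S$ have the same number $s+1$ of vertices, and every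 edge lies in exactly one clique from $S$. For every Steiner $\mathrm T_q(d-1,d,n)$ bitrade $(T_0,T_1)$, the function equal to $1$ on $T_0$, $-1$ on $T_1$ and $0$ elsewhere is an eigenfunction of $J_q(n,d)$ with eigenvalue $\theta=-k/s$. If $W^0=1$, $W^1=\theta$ and $W^i=\big((\theta-a_{i-1})W^{i-1}-b_{i-2}W^{i-2}\big)/c_i$ for $i\ge2$, then $\sum_{i=0}^{D}|W^i|=\prod_{i=1}^{d}(q^{d-i}+1)$. (3) For every Steiner $\mathrm T_q(d-1,d,n)$ bitrade $(T_0,T_1)$ of minimum cardinality, the subgraph of $J_q(n,d)$ induced by $T_0\cup T_1$ is bipartite with parts $T_0,T_1$ and distance-regular, with the same diameter and intersection array as the dual polar graph $D_d(q)$. The vertices of $D_d(q)$ are the $d$-dimensional subspaces of $\mathbb F_q^{2d}$ on which the form $v_1u_1+\dots+v_du_d$ vanishes completely, two of them being adjacent when their intersection has dimension $d-1$; $D_d(q)$ is itself distance-regular. -/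

import Mathlib

noncomputable section

/-- Gaussian binomial coefficient `[a choose b]_q = ∏_{i<b} (q^(a-i) - 1)/(q^(i+1) - 1)`.
(If `b > a`, the factor with index `i = a` vanishes, so truncated subtraction is harmless.) -/
def gaussBinom (q a b : ℕ) : ℝ :=
  ∏ i ∈ Finset.range b, ((q : ℝ) ^ (a - i) - 1) / ((q : ℝ) ^ (i + 1) - 1)

section Graphs

variable {α : Type*}

/-- The graph `G` is distance-regular of diameter `D` with intersection array
`(b 0, …, b (D-1); c 1, …, c D)`: it is connected, every vertex has eccentricity `D`, and for
vertices `x`, `y` at distance `i` the vertex `y` has `b i` neighbours at distance `i + 1` from `x`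
and `c i` neighbours at distance `i - 1` from `x`. It follows that `b D = 0` and `c 0 = 0`;
the values at indices beyond `D` play no role. -/
structure IsDistanceRegularWith (G : SimpleGraph α) (D : ℕ) (b c : ℕ → ℕ) : Prop where
  connected : G.Connected
  dist_le : ∀ x y, G.dist x y ≤ D
  exists_dist_eq : ∀ x, ∃ y, G.dist x y = D
  card_up : ∀ x y, {z | G.Adj y z ∧ G.dist x z = G.dist x y + 1}.ncard = b (G.dist x y)
  card_down : ∀ x y, {z | G.Adj y z ∧ G.dist x z + 1 = G.dist x y}.ncard = c (G.dist x y)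

/-- `f` is an eigenfunction of `G` with eigenvalue `θ`. -/
def IsEigenfunction (G : SimpleGraph α) (f : α → ℝ) (θ : ℝ) : Prop :=
  f ≠ 0 ∧ ∀ x, ∑ᶠ y ∈ G.neighborSet x, f y = θ * f x

/-- The coefficients `W^i_{A,θ}` of the weight distribution of an eigenfunction with eigenvalue
`θ` in a distance-regular graph with intersection array `A = (b; c)`;
here `a i = b 0 - b i - c i`, and `b 0` is the degree of the graph. -/
def wdCoeff (b c : ℕ → ℕ) (θ : ℝ) : ℕ → ℝ
  | 0 => 1
  | 1 => θ
  | i + 2 =>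
    ((θ - ((b 0 : ℝ) - b (i + 1) - c (i + 1))) * wdCoeff b c θ (i + 1)
      - b i * wdCoeff b c θ i) / c (i + 2)

/-- The value `∑_{i=0}^{D} |W^i_{A,θ}|` of the weight-distribution bound. -/
def wdBound (D : ℕ) (b c : ℕ → ℕ) (θ : ℝ) : ℝ :=
  ∑ i ∈ Finset.range (D + 1), |wdCoeff b c θ i|

/-- `(G, S)` is a `(k, s, m)` pair: `G` is connected and regular of degree `k`, and `S` is a set
of `(s + 1)`-cliques such that every edge is included in exactly `m` of them. -/
structure IsCliquePair (G : SimpleGraph α) (S : Set (Set α)) (k s m : ℕ) : Prop where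
  connected : G.Connected
  regular : ∀ x, (G.neighborSet x).ncard = k
  clique : ∀ C ∈ S, G.IsClique C ∧ C.ncard = s + 1
  edge : ∀ x y, G.Adj x y → {C | C ∈ S ∧ x ∈ C ∧ y ∈ C}.ncard = m

/-- `(T₀, T₁)` is an `S`-bitrade, where `S` is a set of cliques. -/
structure IsCliqueBitrade (S : Set (Set α)) (T₀ T₁ : Set α) : Prop where
  disjoint : Disjoint T₀ T₁
  nonempty_left : T₀.Nonempty
  nonempty_right : T₁.Nonempty
  meets : ∀ C ∈ S, ((C ∩ T₀).ncard = 1 ∧ (C ∩ T₁).ncard = 1) ∨ (C ∩ T₀ = ∅ ∧ C ∩ T₁ = ∅)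

/-- The function equal to `1` on `T₀`, to `-1` on `T₁`, and to `0` elsewhere. -/
def bitradeFun (T₀ T₁ : Set α) : α → ℝ :=
  T₀.indicator 1 - T₁.indicator 1

end Graphs

section Grassmann

variable (F V : Type*) [Field F] [AddCommGroup V] [Module F V] (d : ℕ)

/-- The `d`-dimensional subspaces of `V`. -/
def GrassmannVertex : Type _ := {W : Submodule F V // Module.finrank F W = d}

/-- The Grassmann graph: two `d`-dimensional subspaces are adjacent when they are distinct and
intersect in a subspace of dimension `d - 1`. -/
def grassmannGraph : SimpleGraph (GrassmannVertex F V d) where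
  Adj A B := A ≠ B ∧ Module.finrank F (A.1 ⊓ B.1 : Submodule F V) + 1 = d
  symm := ⟨fun A B h => ⟨h.1.symm, by rw [inf_comm]; exact h.2⟩⟩
  loopless := ⟨fun _ h => h.1 rfl⟩

/-- The set of cliques of the Grassmann graph that consist of all `d`-dimensional subspaces
including a fixed `(d - 1)`-dimensional subspace `U`. -/
def steinerCliques : Set (Set (GrassmannVertex F V d)) :=
  {C | ∃ U : Submodule F V, Module.finrank F U + 1 = d ∧ C = {W | U ≤ W.1}}

/-- `(T₀, T₁)` is a Steiner `T_q(d-1, d, n)` bitrade. -/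
def IsSteinerBitrade (T₀ T₁ : Set (GrassmannVertex F V d)) : Prop :=
  IsCliqueBitrade (steinerCliques F V d) T₀ T₁

/-- `(T₀, T₁)` is a Steiner `T_q(d-1, d, n)` bitrade of the minimum cardinality `|T₀ ∪ T₁|`. -/
def IsMinimumSteinerBitrade (T₀ T₁ : Set (GrassmannVertex F V d)) : Prop :=
  IsSteinerBitrade F V d T₀ T₁ ∧
    ∀ R₀ R₁, IsSteinerBitrade F V d R₀ R₁ → (T₀ ∪ T₁).ncard ≤ (R₀ ∪ R₁).ncard

end Grassmann

section DualPolar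

variable (F : Type*) [Field F] (d : ℕ)

/-- The quadratic form `Q₀(v, u) = v₁u₁ + ⋯ + v_du_d` on `F^(2d)`. -/
def hyperbolicForm (p : (Fin d → F) × (Fin d → F)) : F := ∑ i, p.1 i * p.2 i

/-- The `d`-dimensional subspaces on which `Q₀` vanishes completely. -/
def DualPolarVertex : Type _ :=
  {W : Submodule F ((Fin d → F) × (Fin d → F)) //
    Module.finrank F W = d ∧ ∀ p ∈ W, hyperbolicForm F d p = 0}

/-- The dual polar graph `D_d(q)`, where `q` is the order of the field `F`. -/
def dualPolarGraph : SimpleGraph (DualPolarVertex F d) where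
  Adj A B := A ≠ B ∧
    Module.finrank F (A.1 ⊓ B.1 : Submodule F ((Fin d → F) × (Fin d → F))) + 1 = d
  symm := ⟨fun A B h => ⟨h.1.symm, by rw [inf_comm]; exact h.2⟩⟩
  loopless := ⟨fun _ h => h.1 rfl⟩

end DualPolar

end

/-! Let `f` be the `±1` function of a bitrade and `x` a member of it. The values of `f` sum to zero
over all vertices containing a given `(d-1)`-space `U`. Summing this over the `U` with `dim (U ∩ x)
= d-i-1` and exchanging sums gives `[i+1] S_{i+1} = -([d]-[i]) S_i`, where `S_i` is the sum of `f`
over the sphere of radius `i` about `x` (`sphereSum_succ`). Hence `S_i = (-1)^i q^(i choose 2) [d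
choose i] f(x)`, so this sphere has at least `q^(i choose 2) [d choose i]` members. Adding over `i`,
with the `q`-binomial theorem, yields the lower bound; the same two-term relation solves the
recursion for the weight coefficients.

Equality forces the members at distance `i` from `x` to lie all in one part, decided by the parity
of `i`. Two members sharing a hyperplane `U` lie in opposite parts, so their distances to any third
member differ, which means that exactly one of them meets it outside `U`. This is `IsThinFamily`,
and it alone determines the intersection array: the neighbours of `y` correspond to its hyperplanes
`U`, and the neighbour across `U` is nearer to `x` exactly when `y ∩ x ≤ U`.

The maximal totally singular subspaces of the hyperbolic form are also a thin family, so `D_d(q)`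
has the same array by the same lemma. Carried into `V` by an injective linear map and split by
parity of distance, they form a bitrade attaining the bound. -/

/-- The Gaussian integer `[m]_q = 1 + q + ⋯ + q^(m-1)`. -/
def gaussNum (q m : ℕ) : ℕ := ∑ i ∈ Finset.range m, q ^ i

/-! ### Gaussian integers. -/

section GaussNum

variable {q : ℕ}

@[simp] theorem gaussNum_zero : gaussNum q 0 = 0 := by simp [gaussNum]

@[simp] theorem gaussNum_one : gaussNum q 1 = 1 := by simp [gaussNum]

theorem gaussNum_succ (m : ℕ) : gaussNum q (m + 1) = gaussNum q m + q ^ m := by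
  simp [gaussNum, Finset.sum_range_succ]

theorem gaussNum_strictMono (hq : 2 ≤ q) : StrictMono (gaussNum q) :=
  strictMono_nat_of_lt_succ fun m => by
    rw [gaussNum_succ]
    have : 0 < q ^ m := by positivity
    omega

theorem gaussNum_pos (hq : 2 ≤ q) {m : ℕ} (hm : 0 < m) : 0 < gaussNum q m := by
  simpa using gaussNum_strictMono hq hm

theorem gaussNum_cast_mul (m : ℕ) : (gaussNum q m : ℝ) * (q - 1) = (q : ℝ) ^ m - 1 := by
  rw [gaussNum]
  push_cast
  exact geom_sum_mul _ _

end GaussNum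

section Counting

variable {α β : Type*}

theorem Set.ncard_eq_mul_of_fiber {s : Set α} {t : Set β} (hs : s.Finite) (ht : t.Finite)
    (f : α → β) (hf : ∀ x ∈ s, f x ∈ t) {m : ℕ}
    (hm : ∀ y ∈ t, {x | x ∈ s ∧ f x = y}.ncard = m) : s.ncard = t.ncard * m := by
  classical
  lift s to Finset α using hs
  lift t to Finset β using ht
  simp only [Set.ncard_coe_finset, Finset.mem_coe] at *
  rw [Finset.card_eq_sum_card_fiberwise (f := f) (t := t) (by simpa [Set.MapsTo] using hf)]
  refine Finset.sum_const_nat fun y hy => ?_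
  rw [← hm y hy, ← Set.ncard_coe_finset]
  simp

end Counting

/-! ### Counting subspaces of a finite vector space. -/

section Subspaces

variable {F V : Type*} [Field F] [AddCommGroup V] [Module F V]

open Module

theorem Submodule.sup_span_eq_of_finrank_succ [FiniteDimensional F V] {U W : Submodule F V}
    (h : U ≤ W) (hf : finrank F W = finrank F U + 1) {v : V} (hv : v ∈ W) (hvU : v ∉ U) :
    U ⊔ F ∙ v = W := by
  refine Submodule.eq_of_le_of_finrank_eq (sup_le h ?_) ?_
  · simpa using hv
  · rw [finrank_sup_span_singleton hvU, hf]

/-- A vector of `W ⊓ X` outside `U` already spans `W` together with `U`, so `W ⊓ X ⊔ U = W` and the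
dimension formula applies. -/
theorem Submodule.finrank_inf_eq_succ [FiniteDimensional F V] {U W X : Submodule F V}
    (h : U ≤ W) (hf : finrank F W = finrank F U + 1) (hX : ¬ W ⊓ X ≤ U) :
    finrank F (W ⊓ X : Submodule F V) = finrank F (U ⊓ X : Submodule F V) + 1 := by
  obtain ⟨v, hv, hvU⟩ := SetLike.not_le_iff_exists.1 hX
  have h1 := Submodule.finrank_sup_add_finrank_inf_eq (W ⊓ X) U
  have h2 : W ⊓ X ⊔ U = W := by
    refine le_antisymm (sup_le inf_le_left h) ?_
    exact (Submodule.sup_span_eq_of_finrank_succ h hf hv.1 hvU).ge.trans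
      (sup_le le_sup_right (le_sup_of_le_left ((Submodule.span_singleton_le_iff_mem _ _).2 hv)))
  have h3 : W ⊓ X ⊓ U = U ⊓ X := by
    rw [inf_right_comm, inf_eq_right.2 h]
  rw [h2, h3] at h1
  omega

theorem Submodule.inf_eq_inf_of_inf_le {U W X : Submodule F V} (h : U ≤ W) (hX : W ⊓ X ≤ U) :
    W ⊓ X = U ⊓ X :=
  le_antisymm (le_inf hX inf_le_right) (inf_le_inf_right _ h)

variable [Finite F] [FiniteDimensional F V]

/-- The map `v ↦ U + Fv` from `Y \ U` onto these `W` has the fibres `W \ U`, all of the same size.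
-/
theorem ncard_extensions {U Y : Submodule F V} (hUY : U ≤ Y) :
    {W : Submodule F V | U ≤ W ∧ W ≤ Y ∧ finrank F W = finrank F U + 1}.ncard =
      gaussNum (Nat.card F) (finrank F Y - finrank F U) := by
  have : Finite V := Module.finite_of_finite F
  have hq : 1 < Nat.card F := Finite.one_lt_card
  set q := Nat.card F with hqd
  have hdiff : ∀ {A B : Submodule F V}, A ≤ B →
      ((B : Set V) \ A).ncard + q ^ finrank F A = q ^ finrank F B := by
    intro A B h
    have e : ∀ C : Submodule F V, (C : Set V).ncard = q ^ finrank F C := fun C => by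
      rw [hqd, ← Module.natCard_eq_pow_finrank (K := F) (V := C)]; rfl
    rw [← e, ← e]
    exact Set.ncard_sdiff_add_ncard_of_subset h
  have key := Set.ncard_eq_mul_of_fiber (s := (Y : Set V) \ U)
    (t := {W : Submodule F V | U ≤ W ∧ W ≤ Y ∧ finrank F W = finrank F U + 1})
    (Set.toFinite _) (Set.toFinite _) (fun v => U ⊔ F ∙ v)
    (by
      rintro v ⟨hv, hvU⟩
      refine ⟨le_sup_left, sup_le hUY (by simpa using hv),
        Submodule.finrank_sup_span_singleton hvU⟩)
    (m := q ^ (finrank F U + 1) - q ^ finrank F U)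
    (by
      rintro W ⟨hUW, hWY, hW⟩
      have h1 := hdiff hUW
      rw [hW] at h1
      rw [← h1, Nat.add_sub_cancel]
      congr 1
      ext v
      constructor
      · rintro ⟨⟨hv, hvU⟩, rfl⟩
        exact ⟨Submodule.mem_sup_right (Submodule.mem_span_singleton_self v), hvU⟩
      · rintro ⟨hv, hvU⟩
        exact ⟨⟨hWY hv, hvU⟩, Submodule.sup_span_eq_of_finrank_succ hUW hW hv hvU⟩)
  have h1 := hdiff hUY
  rw [key] at h1
  obtain ⟨m, hm⟩ := Nat.exists_eq_add_of_le (Submodule.finrank_mono hUY)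
  rw [hm, Nat.add_sub_cancel_left]
  rw [hm] at h1
  generalize Set.ncard _ = N at h1
  have hg := Nat.geomSum_eq (m := q) hq m
  have h0 : 0 < q ^ finrank F U := by positivity
  -- Over `ℤ`, after cancelling `q ^ finrank U`, the count satisfies the equation that defines the
  -- geometric sum.
  have h2 : (N : ℤ) * (q - 1) = q ^ m - 1 := by
    have h3 : q ^ finrank F U ≤ q ^ (finrank F U + 1) := Nat.pow_le_pow_right (by omega) (by omega)
    zify [h3] at h1
    have h4 : (q : ℤ) ^ finrank F U ≠ 0 := by positivity
    apply mul_left_cancel₀ h4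
    ring_nf at h1 ⊢
    linarith
  have h5 : (gaussNum q m : ℤ) * (q - 1) = q ^ m - 1 := by
    rw [gaussNum]; push_cast; exact geom_sum_mul _ _
  have h6 : (q : ℤ) - 1 ≠ 0 := by omega
  exact_mod_cast mul_right_cancel₀ h6 (h2.trans h5.symm)

/-- Annihilators turn hyperplanes of `Y` over `X` into one-step extensions of the annihilator of `Y`
in the dual space. -/
theorem ncard_hyperplanes {X Y : Submodule F V} (hXY : X ≤ Y) :
    {H : Submodule F V | X ≤ H ∧ H ≤ Y ∧ finrank F H + 1 = finrank F Y}.ncard =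
      gaussNum (Nat.card F) (finrank F Y - finrank F X) := by
  have hfin := fun W : Submodule F V => Subspace.finrank_add_finrank_dualAnnihilator_eq W
  have h := ncard_extensions (Submodule.dualAnnihilator_anti hXY)
  have hX := hfin X
  have hY := hfin Y
  have hXY' := Submodule.finrank_mono hXY
  rw [show finrank F Y - finrank F X =
    finrank F X.dualAnnihilator - finrank F Y.dualAnnihilator by omega, ← h]
  refine Set.ncard_congr (fun W _ => W.dualAnnihilator) ?_ ?_ ?_
  · rintro H ⟨h1, h2, h3⟩
    refine ⟨Submodule.dualAnnihilator_anti h2, Submodule.dualAnnihilator_anti h1, ?_⟩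
    have := hfin H
    omega
  · intro A B _ _ hAB
    exact Subspace.dualAnnihilator_inj.1 hAB
  · rintro W ⟨h1, h2, h3⟩
    refine ⟨W.dualCoannihilator, ⟨?_, ?_, ?_⟩, Subspace.dualCoannihilator_dualAnnihilator_eq⟩
    · simpa [Subspace.dualAnnihilator_dualCoannihilator_eq] using
        Submodule.dualCoannihilator_anti h2
    · simpa [Subspace.dualAnnihilator_dualCoannihilator_eq] using
        Submodule.dualCoannihilator_anti h1
    · have := hfin W.dualCoannihilator
      rw [Subspace.dualCoannihilator_dualAnnihilator_eq] at this
      omega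

end Subspaces

/-! ### Recognising the graph distance from a numerical function. -/

section Gauge

variable {α : Type*} {G : SimpleGraph α} {δ : α → α → ℕ}

/-- Descending along `hdown` builds a walk of length `δ x y`; the Lipschitz condition shows that
none is shorter. -/
theorem SimpleGraph.dist_eq_of_gauge (h0 : ∀ x y, δ x y = 0 ↔ x = y)
    (hlip : ∀ x y z, G.Adj y z → δ x z ≤ δ x y + 1)
    (hdown : ∀ x y m, δ x y = m + 1 → ∃ z, G.Adj y z ∧ δ x z = m) (x y : α) :
    G.Reachable x y ∧ G.dist x y = δ x y := by
  have hwalk : ∀ m y, δ x y = m → ∃ p : G.Walk x y, p.length = m := by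
    intro m
    induction m with
    | zero =>
      intro y hy
      obtain rfl := (h0 x y).1 hy
      exact ⟨.nil, rfl⟩
    | succ m ih =>
      intro y hy
      obtain ⟨z, hz, hm⟩ := hdown x y m hy
      obtain ⟨p, hp⟩ := ih z hm
      exact ⟨p.concat hz.symm, by simp [hp]⟩
  have hle : ∀ {u v : α} (p : G.Walk u v), δ x v ≤ δ x u + p.length := by
    intro u v p
    induction p with
    | nil => simp
    | cons h p ih =>
      have := hlip x _ _ h
      simp only [SimpleGraph.Walk.length_cons]
      omega
  obtain ⟨p, hp⟩ := hwalk _ y rfl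
  refine ⟨⟨p⟩, le_antisymm (hp ▸ SimpleGraph.dist_le p) ?_⟩
  obtain ⟨r, hr⟩ := SimpleGraph.Reachable.exists_walk_length_eq_dist ⟨p⟩
  have := hle r
  rw [(h0 x x).2 rfl] at this
  omega

theorem isDistanceRegularWith_of_gauge [Nonempty α] {D : ℕ} {b c : ℕ → ℕ}
    (h0 : ∀ x y, δ x y = 0 ↔ x = y) (hlip : ∀ x y z, G.Adj y z → δ x z ≤ δ x y + 1)
    (hle : ∀ x y, δ x y ≤ D)
    (hup : ∀ x y, {z | G.Adj y z ∧ δ x z = δ x y + 1}.ncard = b (δ x y))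
    (hdown : ∀ x y, {z | G.Adj y z ∧ δ x z + 1 = δ x y}.ncard = c (δ x y))
    (hb : ∀ i < D, 0 < b i) (hc : ∀ i, 0 < i → i ≤ D → 0 < c i) :
    IsDistanceRegularWith G D b c := by
  have hd : ∀ x y, G.Reachable x y ∧ G.dist x y = δ x y := by
    refine SimpleGraph.dist_eq_of_gauge h0 hlip fun x y m hm => ?_
    have h := hc (δ x y) (by omega) (hle x y)
    rw [← hdown] at h
    obtain ⟨z, hz, hz'⟩ := Set.nonempty_of_ncard_ne_zero h.ne'
    exact ⟨z, hz, by omega⟩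
  have hdist : ∀ x y, G.dist x y = δ x y := fun x y => (hd x y).2
  refine ⟨⟨fun x y => (hd x y).1⟩, ?_, fun x => ?_, ?_, ?_⟩
  · simpa [hdist] using hle
  · simp only [hdist]
    have : ∀ i ≤ D, ∃ y, δ x y = i := by
      intro i
      induction i with
      | zero => exact fun _ => ⟨x, (h0 x x).2 rfl⟩
      | succ i ih =>
        intro hi
        obtain ⟨y, hy⟩ := ih (by omega)
        have h := hb (δ x y) (by omega)
        rw [← hup] at h
        obtain ⟨z, -, hz⟩ := Set.nonempty_of_ncard_ne_zero h.ne'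
        exact ⟨z, by omega⟩
    exact this D le_rfl
  · simpa only [hdist] using hup
  · simpa only [hdist] using hdown

end Gauge

/-! ### Distance-regularity and cliques of the Grassmann graph. -/

section GrassmannCounts

variable {F V : Type*} [Field F] [AddCommGroup V] [Module F V] {d : ℕ}

open Module

/-- The codimension of `y ∩ x` in `y`, which is the distance of `x` and `y` in the Grassmann
graph. -/
noncomputable def grassmannGauge (x y : GrassmannVertex F V d) : ℕ :=
  d - finrank F (y.1 ⊓ x.1 : Submodule F V)

variable [FiniteDimensional F V]

theorem Submodule.le_sup_iff_not_inf_le {U W X : Submodule F V}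
    (h : U ≤ W) (hf : finrank F W = finrank F U + 1) : W ≤ U ⊔ X ↔ ¬ W ⊓ X ≤ U := by
  constructor
  · intro hW hX
    have h1 : W = U := by
      refine le_antisymm ?_ h
      calc W ≤ (U ⊔ X) ⊓ W := le_inf hW le_rfl
        _ = U ⊔ X ⊓ W := (sup_inf_assoc_of_le X h)
        _ ≤ U := sup_le le_rfl (by rwa [inf_comm])
    rw [h1] at hf
    omega
  · intro hX
    obtain ⟨v, hv, hvU⟩ := SetLike.not_le_iff_exists.1 hX
    rw [← Submodule.sup_span_eq_of_finrank_succ h hf hv.1 hvU]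
    exact sup_le_sup_left ((Submodule.span_singleton_le_iff_mem _ _).2 hv.2) _

theorem finrank_inf_le_vertex (x : Submodule F V) (y : GrassmannVertex F V d) :
    finrank F (y.1 ⊓ x : Submodule F V) ≤ d :=
  (Submodule.finrank_mono inf_le_left).trans y.2.le

theorem grassmannGauge_eq_zero_iff {x y : GrassmannVertex F V d} :
    grassmannGauge x y = 0 ↔ x = y := by
  have h := finrank_inf_le_vertex x.1 y
  rw [grassmannGauge]
  constructor
  · intro h0
    have h1 : y.1 ⊓ x.1 = y.1 :=
      Submodule.eq_of_le_of_finrank_eq inf_le_left (by rw [y.2]; omega)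
    have h2 : y.1 ⊓ x.1 = x.1 :=
      Submodule.eq_of_le_of_finrank_eq inf_le_right (by rw [x.2]; omega)
    exact Subtype.ext (h2.symm.trans h1)
  · rintro rfl
    rw [inf_idem, x.2, Nat.sub_self]

/-- The dichotomy behind every distance comparison: passing from `U` to a vertex above it either
adds nothing to the intersection with `x` or adds one dimension. -/
theorem finrank_inf_hyperplane {U : Submodule F V} (hU : finrank F U + 1 = d) (x : Submodule F V)
    {y : GrassmannVertex F V d} (hy : U ≤ y.1) :
    (y.1 ⊓ x ≤ U ∧ finrank F (y.1 ⊓ x : Submodule F V) = finrank F (U ⊓ x : Submodule F V)) ∨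
    (¬ y.1 ⊓ x ≤ U ∧
      finrank F (y.1 ⊓ x : Submodule F V) = finrank F (U ⊓ x : Submodule F V) + 1) := by
  by_cases h : y.1 ⊓ x ≤ U
  · exact .inl ⟨h, by rw [Submodule.inf_eq_inf_of_inf_le hy h]⟩
  · exact .inr ⟨h, Submodule.finrank_inf_eq_succ hy (by rw [y.2, hU]) h⟩

theorem inf_eq_of_ne {U : Submodule F V} (hU : finrank F U + 1 = d)
    {y z : GrassmannVertex F V d} (hy : U ≤ y.1) (hz : U ≤ z.1) (hyz : y ≠ z) :
    y.1 ⊓ z.1 = U := by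
  rcases finrank_inf_hyperplane hU z.1 hy with h | h
  · exact le_antisymm h.1 (le_inf hy hz)
  · have h2 := h.2
    rw [inf_eq_left.2 hz, hU] at h2
    have h3 := grassmannGauge_eq_zero_iff (x := z) (y := y)
    rw [grassmannGauge, h2] at h3
    exact absurd (h3.1 (by omega)).symm hyz

theorem grassmannGraph_adj_of_le {U : Submodule F V} (hU : finrank F U + 1 = d)
    {y z : GrassmannVertex F V d} (hy : U ≤ y.1) (hz : U ≤ z.1) (hyz : y ≠ z) :
    (grassmannGraph F V d).Adj y z :=
  ⟨hyz, by rw [inf_eq_of_ne hU hy hz hyz, hU]⟩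

theorem grassmannGauge_le_succ (x : GrassmannVertex F V d) {y z : GrassmannVertex F V d}
    (h : (grassmannGraph F V d).Adj y z) : grassmannGauge x z ≤ grassmannGauge x y + 1 := by
  have h1 := finrank_inf_hyperplane h.2 x.1 inf_le_left
  have h2 := finrank_inf_hyperplane h.2 x.1 inf_le_right
  rw [grassmannGauge, grassmannGauge]
  omega

theorem grassmannGauge_eq_succ_iff (x : GrassmannVertex F V d) {y z : GrassmannVertex F V d}
    (h : (grassmannGraph F V d).Adj y z) :
    grassmannGauge x z = grassmannGauge x y + 1 ↔
      ¬ y.1 ⊓ x.1 ≤ y.1 ⊓ z.1 ∧ z.1 ⊓ x.1 ≤ y.1 ⊓ z.1 := by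
  have h1 := finrank_inf_hyperplane h.2 x.1 inf_le_left
  have h2 := finrank_inf_hyperplane h.2 x.1 inf_le_right
  have h3 := finrank_inf_le_vertex x.1 y
  have h4 := finrank_inf_le_vertex x.1 z
  rw [grassmannGauge, grassmannGauge]
  constructor
  · intro h5
    rcases h1 with h1 | h1 <;> rcases h2 with h2 | h2
    · omega
    · omega
    · exact ⟨h1.1, h2.1⟩
    · omega
  · rintro ⟨h5, h6⟩
    simp only [h5, h6, false_and, not_true, not_false_eq_true, true_and, false_or, or_false]
      at h1 h2
    omega

theorem grassmannGauge_succ_eq_iff (x : GrassmannVertex F V d) {y z : GrassmannVertex F V d}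
    (h : (grassmannGraph F V d).Adj y z) :
    grassmannGauge x z + 1 = grassmannGauge x y ↔
      y.1 ⊓ x.1 ≤ y.1 ⊓ z.1 ∧ ¬ z.1 ⊓ x.1 ≤ y.1 ⊓ z.1 := by
  rw [eq_comm, grassmannGauge_eq_succ_iff x h.symm, and_comm, inf_comm z.1 y.1]

variable [Finite F]

instance : Finite (GrassmannVertex F V d) :=
  have : Finite V := Module.finite_of_finite F
  inferInstanceAs (Finite {W : Submodule F V // finrank F W = d})

instance : Finite (Submodule F V) :=
  have : Finite V := Module.finite_of_finite F
  inferInstance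

theorem ncard_vertices_between {U Y : Submodule F V} (hU : finrank F U + 1 = d) (hY : U ≤ Y) :
    {z : GrassmannVertex F V d | U ≤ z.1 ∧ z.1 ≤ Y}.ncard =
      gaussNum (Nat.card F) (finrank F Y + 1 - d) := by
  rw [show finrank F Y + 1 - d = finrank F Y - finrank F U by omega, ← ncard_extensions hY]
  refine Set.ncard_congr (fun z _ => z.1) ?_ ?_ ?_
  · rintro z ⟨h1, h2⟩
    exact ⟨h1, h2, z.2.trans hU.symm⟩
  · exact fun _ _ _ _ h => Subtype.ext h
  · rintro W ⟨h1, h2, h3⟩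
    exact ⟨⟨W, h3.trans hU⟩, ⟨h1, h2⟩, rfl⟩

theorem ncard_vertices_ge {U : Submodule F V} (hU : finrank F U + 1 = d) :
    {z : GrassmannVertex F V d | U ≤ z.1}.ncard =
      gaussNum (Nat.card F) (finrank F V + 1 - d) := by
  rw [← finrank_top F V, ← ncard_vertices_between hU le_top]
  simp

theorem ncard_vertices_inf_not_le {U : Submodule F V} (hU : finrank F U + 1 = d)
    (x : GrassmannVertex F V d) :
    {z : GrassmannVertex F V d | U ≤ z.1 ∧ ¬ z.1 ⊓ x.1 ≤ U}.ncard =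
      gaussNum (Nat.card F) (d - finrank F (U ⊓ x.1 : Submodule F V)) := by
  have h := Submodule.finrank_sup_add_finrank_inf_eq U x.1
  have h1 := Submodule.finrank_mono (inf_le_left : U ⊓ x.1 ≤ U)
  rw [x.2] at h
  rw [show d - finrank F (U ⊓ x.1 : Submodule F V) =
    finrank F (U ⊔ x.1 : Submodule F V) + 1 - d by omega,
    ← ncard_vertices_between hU le_sup_left]
  congr 1
  ext z
  refine and_congr_right fun hz => ?_
  rw [Submodule.le_sup_iff_not_inf_le hz (z.2.trans hU.symm)]

theorem ncard_hyperplanes_ge (x : Submodule F V) (y : GrassmannVertex F V d) :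
    {U : Submodule F V | (U ≤ y.1 ∧ finrank F U + 1 = d) ∧ y.1 ⊓ x ≤ U}.ncard =
      gaussNum (Nat.card F) (d - finrank F (y.1 ⊓ x : Submodule F V)) := by
  have h := ncard_hyperplanes (inf_le_left : y.1 ⊓ x ≤ y.1)
  rw [y.2] at h
  rw [← h]
  congr 1
  ext U
  simp only [Set.mem_ofPred_eq]
  tauto

theorem ncard_hyperplanes_all (y : GrassmannVertex F V d) :
    {U : Submodule F V | U ≤ y.1 ∧ finrank F U + 1 = d}.ncard = gaussNum (Nat.card F) d := by
  have h := ncard_hyperplanes_ge ⊥ y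
  rw [inf_bot_eq, finrank_bot, Nat.sub_zero] at h
  simpa using h

theorem ncard_hyperplanes_not_ge (x : Submodule F V) (y : GrassmannVertex F V d) :
    {U : Submodule F V | (U ≤ y.1 ∧ finrank F U + 1 = d) ∧ ¬ y.1 ⊓ x ≤ U}.ncard =
      gaussNum (Nat.card F) d -
        gaussNum (Nat.card F) (d - finrank F (y.1 ⊓ x : Submodule F V)) := by
  rw [← ncard_hyperplanes_all y, ← ncard_hyperplanes_ge x y, ← Set.ncard_sdiff (by grind)
    (Set.toFinite _)]
  congr 1
  ext U
  simp only [Set.mem_ofPred_eq, Set.mem_sdiff]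
  tauto

/-- Neighbours `z` are fibred over the hyperplane `U = y ∩ z`. The hypothesis `hy` keeps `y` itself
out of the fibre, so that every vertex counted there is a neighbour. -/
theorem ncard_neighbors_eq_mul (y : GrassmannVertex F V d) (P : Submodule F V → Prop)
    (Q : Submodule F V → Submodule F V → Prop) {m : ℕ}
    (hy : ∀ U, P U → ¬ Q U y.1)
    (h : ∀ U ≤ y.1, finrank F U + 1 = d → P U →
      {z : GrassmannVertex F V d | U ≤ z.1 ∧ Q U z.1}.ncard = m) :
    {z | (grassmannGraph F V d).Adj y z ∧ P (y.1 ⊓ z.1) ∧ Q (y.1 ⊓ z.1) z.1}.ncard =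
      {U : Submodule F V | (U ≤ y.1 ∧ finrank F U + 1 = d) ∧ P U}.ncard * m := by
  refine Set.ncard_eq_mul_of_fiber (Set.toFinite _) (Set.toFinite _) (fun z => y.1 ⊓ z.1)
    (fun z hz => Set.mem_ofPred.2 ⟨⟨inf_le_left, hz.1.2⟩, hz.2.1⟩) ?_
  rintro U ⟨⟨hUy, hU⟩, hP⟩
  rw [← h U hUy hU hP]
  congr 1
  ext z
  constructor
  · rintro ⟨⟨-, -, hQ⟩, rfl⟩
    exact ⟨inf_le_right, hQ⟩
  · rintro ⟨hUz, hQ⟩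
    have hne : y ≠ z := by
      rintro rfl
      exact hy U hP hQ
    have hi := inf_eq_of_ne hU hUy hUz hne
    exact ⟨⟨grassmannGraph_adj_of_le hU hUy hUz hne, hi.symm ▸ hP, hi.symm ▸ hQ⟩, hi⟩

theorem grassmannGraph_degree (y : GrassmannVertex F V d) :
    ((grassmannGraph F V d).neighborSet y).ncard =
      gaussNum (Nat.card F) d * (gaussNum (Nat.card F) (finrank F V + 1 - d) - 1) := by
  have h := ncard_neighbors_eq_mul y (fun _ => True) (fun _ W => W ≠ y.1)
    (m := gaussNum (Nat.card F) (finrank F V + 1 - d) - 1) (by simp) (by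
      intro U hUy hU _
      rw [← ncard_vertices_ge hU, ← Set.ncard_sdiff_singleton_of_mem (a := y) hUy]
      congr 1
      ext z
      exact and_congr_right fun _ => not_congr Subtype.ext_iff.symm)
  simp only [and_true, true_and, ncard_hyperplanes_all] at h
  rw [← h]
  congr 1
  ext z
  exact ⟨fun hz => ⟨hz, fun e => hz.1 (Subtype.ext e.symm)⟩, fun hz => hz.1⟩

/-- A neighbour is nearer when `U` contains `y ∩ x` and `z` meets `x` outside `U`, that is, `z ≤ U ⊔
x`. Each choice can be made in `[i]` ways. -/
theorem grassmannGraph_card_down (x y : GrassmannVertex F V d) :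
    {z | (grassmannGraph F V d).Adj y z ∧ grassmannGauge x z + 1 = grassmannGauge x y}.ncard =
      gaussNum (Nat.card F) (grassmannGauge x y) ^ 2 := by
  have h := ncard_neighbors_eq_mul y (fun U => y.1 ⊓ x.1 ≤ U) (fun U W => ¬ W ⊓ x.1 ≤ U)
    (m := gaussNum (Nat.card F) (grassmannGauge x y)) (fun U hU => not_not.2 hU) (by
      intro U hUy hU hx
      rw [ncard_vertices_inf_not_le hU, ← Submodule.inf_eq_inf_of_inf_le hUy hx, grassmannGauge])
  rw [ncard_hyperplanes_ge, ← grassmannGauge, ← sq] at h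
  rw [← h]
  congr 1
  ext z
  exact and_congr_right fun hz => grassmannGauge_succ_eq_iff x hz

/-- Here `U` omits part of `y ∩ x`, so `U ∩ x` loses one dimension; this is the source of the index
`i + 1` in the second factor. -/
theorem grassmannGraph_card_up (x y : GrassmannVertex F V d) :
    {z | (grassmannGraph F V d).Adj y z ∧ grassmannGauge x z = grassmannGauge x y + 1}.ncard =
      (gaussNum (Nat.card F) d - gaussNum (Nat.card F) (grassmannGauge x y)) *
        (gaussNum (Nat.card F) (finrank F V + 1 - d) -
          gaussNum (Nat.card F) (grassmannGauge x y + 1)) := by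
  have h := ncard_neighbors_eq_mul y (fun U => ¬ y.1 ⊓ x.1 ≤ U) (fun U W => W ⊓ x.1 ≤ U)
    (m := gaussNum (Nat.card F) (finrank F V + 1 - d) -
          gaussNum (Nat.card F) (grassmannGauge x y + 1)) (fun U hU => hU) (by
      intro U hUy hU hx
      have h1 := finrank_inf_hyperplane hU x.1 hUy
      have h2 := finrank_inf_le_vertex x.1 y
      rw [grassmannGauge, show d - finrank F (y.1 ⊓ x.1 : Submodule F V) + 1 =
        d - finrank F (U ⊓ x.1 : Submodule F V) by
          have h3 := (h1.resolve_left fun h => hx h.1).2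
          omega,
        ← ncard_vertices_inf_not_le hU, ← ncard_vertices_ge hU,
        ← Set.ncard_sdiff (by grind) (Set.toFinite _)]
      congr 1
      ext z
      simp only [Set.mem_ofPred_eq, Set.mem_sdiff]
      tauto)
  rw [ncard_hyperplanes_not_ge, ← grassmannGauge] at h
  rw [← h]
  congr 1
  ext z
  exact and_congr_right fun hz => grassmannGauge_eq_succ_iff x hz

theorem grassmannGraph_isDistanceRegularWith (hd : 2 * d ≤ finrank F V) :
    IsDistanceRegularWith (grassmannGraph F V d) d
      (fun i => (gaussNum (Nat.card F) d - gaussNum (Nat.card F) i) *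
        (gaussNum (Nat.card F) (finrank F V + 1 - d) - gaussNum (Nat.card F) (i + 1)))
      (fun i => gaussNum (Nat.card F) i ^ 2) := by
  have hq : 2 ≤ Nat.card F := Finite.one_lt_card
  have hlt : ∀ {i j}, i < j → 0 < gaussNum (Nat.card F) j - gaussNum (Nat.card F) i :=
    fun h => Nat.sub_pos_of_lt (gaussNum_strictMono hq h)
  obtain ⟨f, hf⟩ := (finrank_le_iff_exists_linearMap (R := F) (M := Fin d → F) (M' := V)).1
    (by rw [Module.finrank_fin_fun]; omega)
  have : Nonempty (GrassmannVertex F V d) :=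
    ⟨⟨LinearMap.range f, by rw [LinearMap.finrank_range_of_inj hf, Module.finrank_fin_fun]⟩⟩
  exact isDistanceRegularWith_of_gauge (δ := grassmannGauge)
    (fun _ _ => grassmannGauge_eq_zero_iff) (fun x _ _ h => grassmannGauge_le_succ x h)
    (fun _ _ => Nat.sub_le _ _) grassmannGraph_card_up grassmannGraph_card_down
    (fun i hi => Nat.mul_pos (hlt hi) (hlt (by omega)))
    (fun i hi _ => pow_pos (gaussNum_pos hq hi) 2)

theorem grassmannGraph_isCliquePair (hd : 2 * d ≤ finrank F V) :
    IsCliquePair (grassmannGraph F V d) (steinerCliques F V d)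
      (gaussNum (Nat.card F) d * (gaussNum (Nat.card F) (finrank F V + 1 - d) - 1))
      (gaussNum (Nat.card F) (finrank F V + 1 - d) - 1) 1 where
  connected := (grassmannGraph_isDistanceRegularWith hd).connected
  regular := grassmannGraph_degree
  clique := by
    rintro C ⟨U, hU, rfl⟩
    refine ⟨fun y hy z hz hyz => grassmannGraph_adj_of_le hU hy hz hyz, ?_⟩
    rw [ncard_vertices_ge hU, Nat.sub_add_cancel]
    exact gaussNum_pos Finite.one_lt_card (by omega)
  edge := by
    intro x y h
    rw [Set.ncard_eq_one]
    refine ⟨{W | x.1 ⊓ y.1 ≤ W.1}, Set.eq_singleton_iff_unique_mem.2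
      ⟨⟨⟨_, h.2, rfl⟩, Set.mem_ofPred.2 inf_le_left, Set.mem_ofPred.2 inf_le_right⟩, ?_⟩⟩
    rintro C ⟨⟨U, hU, rfl⟩, hx, hy⟩
    rw [inf_eq_of_ne hU hx hy h.1]

end GrassmannCounts

/-! ### Gaussian binomials and the weight-distribution bound. -/

section GaussBinomial

variable {q : ℕ} {d : ℕ}

/-- The absolute value `q^(i choose 2) [d choose i]_q` of the `i`-th weight coefficient; it is also
the number of vertices at distance `i` from a fixed vertex in the dual polar graph. -/
noncomputable def polarWeight (q d i : ℕ) : ℝ := (q : ℝ) ^ i.choose 2 * gaussBinom q d i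

theorem cast_pow_succ_sub_one_ne_zero (hq : 2 ≤ q) (i : ℕ) : (q : ℝ) ^ (i + 1) - 1 ≠ 0 := by
  have : (1 : ℝ) < (q : ℝ) ^ (i + 1) := one_lt_pow₀ (by exact_mod_cast hq) (by omega)
  linarith

theorem gaussBinom_zero (d : ℕ) : gaussBinom q d 0 = 1 := by simp [gaussBinom]

theorem gaussBinom_succ_right (d i : ℕ) : gaussBinom q d (i + 1) =
    gaussBinom q d i * (((q : ℝ) ^ (d - i) - 1) / ((q : ℝ) ^ (i + 1) - 1)) := by
  rw [gaussBinom, Finset.prod_range_succ, ← gaussBinom]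

theorem gaussBinom_succ_succ (d i : ℕ) : gaussBinom q (d + 1) (i + 1) =
    gaussBinom q d i * (((q : ℝ) ^ (d + 1) - 1) / ((q : ℝ) ^ (i + 1) - 1)) := by
  simp only [gaussBinom, Finset.prod_div_distrib]
  rw [Finset.prod_range_succ' (fun j => (q : ℝ) ^ (d + 1 - j) - 1),
    Finset.prod_range_succ (fun j => (q : ℝ) ^ (j + 1) - 1), mul_div_mul_comm]
  simp

theorem gaussBinom_succ_self (d : ℕ) : gaussBinom q d (d + 1) = 0 := by
  simp [gaussBinom_succ_right]

theorem gaussBinom_pascal (hq : 2 ≤ q) {d i : ℕ} (hi : i ≤ d) : gaussBinom q (d + 1) (i + 1) =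
    gaussBinom q d (i + 1) + (q : ℝ) ^ (d - i) * gaussBinom q d i := by
  have h := cast_pow_succ_sub_one_ne_zero hq i
  rw [gaussBinom_succ_succ, gaussBinom_succ_right]
  have : (q : ℝ) ^ (d + 1) = q ^ (d - i) * q ^ (i + 1) := by
    rw [← pow_add]
    congr 1
    omega
  field_simp
  rw [this]
  ring

theorem polarWeight_zero (d : ℕ) : polarWeight q d 0 = 1 := by
  simp [polarWeight, gaussBinom_zero]

/-- Up to sign this is the recursion of the sphere sums; it is also `c_{i+1} k_{i+1} = b_i k_i` for
the sphere sizes of the dual polar graph. -/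
theorem polarWeight_succ_mul (hq : 2 ≤ q) {i : ℕ} (hi : i ≤ d) :
    (gaussNum q (i + 1) : ℝ) * polarWeight q d (i + 1) =
      ((gaussNum q d : ℝ) - gaussNum q i) * polarWeight q d i := by
  have h1 : (q : ℝ) - 1 ≠ 0 := by simpa using cast_pow_succ_sub_one_ne_zero hq 0
  have h := cast_pow_succ_sub_one_ne_zero hq i
  apply mul_right_cancel₀ h1
  rw [mul_right_comm, mul_right_comm (_ - _), sub_mul, gaussNum_cast_mul, gaussNum_cast_mul,
    gaussNum_cast_mul, polarWeight, polarWeight, gaussBinom_succ_right, Nat.choose_succ_succ' i 1,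
    Nat.choose_one_right]
  have : (q : ℝ) ^ d = q ^ i * q ^ (d - i) := by
    rw [← pow_add]
    congr 1
    omega
  rw [this]
  generalize (q : ℝ) ^ (i + 1) - 1 = A at h ⊢
  rw [pow_add]
  field_simp
  ring

theorem polarWeight_pos (hq : 2 ≤ q) : ∀ {i : ℕ}, i ≤ d → 0 < polarWeight q d i
  | 0, _ => by rw [polarWeight_zero]; exact one_pos
  | i + 1, hi => by
    have h1 : (0 : ℝ) < gaussNum q (i + 1) := by exact_mod_cast gaussNum_pos hq (Nat.succ_pos i)
    have h2 : (gaussNum q i : ℝ) < gaussNum q d := by exact_mod_cast gaussNum_strictMono hq hi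
    refine pos_of_mul_pos_right ?_ h1.le
    rw [polarWeight_succ_mul hq (by omega)]
    exact mul_pos (sub_pos.2 h2) (polarWeight_pos hq (by omega))

/-- The `q`-binomial theorem at `1`, by induction through the Pascal rule. -/
theorem prod_range_pow_add_one (hq : 2 ≤ q) (d : ℕ) :
    ∏ j ∈ Finset.range d, ((q : ℝ) ^ j + 1) =
      ∑ i ∈ Finset.range (d + 1), polarWeight q d i := by
  induction d with
  | zero => simp [polarWeight_zero]
  | succ d ih =>
    rw [Finset.prod_range_succ, ih, Finset.sum_range_succ' _ (d + 1), polarWeight_zero]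
    have h : ∀ i ∈ Finset.range (d + 1), polarWeight q (d + 1) (i + 1) =
        polarWeight q d (i + 1) + (q : ℝ) ^ d * polarWeight q d i := by
      intro i hi
      have hi' : i ≤ d := by simpa [Nat.lt_succ_iff] using hi
      rw [polarWeight, gaussBinom_pascal hq hi', polarWeight, polarWeight,
        Nat.choose_succ_succ' i 1, Nat.choose_one_right, pow_add]
      have : (q : ℝ) ^ d = q ^ i * q ^ (d - i) := by
        rw [← pow_add]
        congr 1
        omega
      rw [this]
      ring
    rw [Finset.sum_congr rfl h, Finset.sum_add_distrib, ← Finset.mul_sum]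
    have h2 := Finset.sum_range_succ' (polarWeight q d) (d + 1)
    rw [Finset.sum_range_succ, polarWeight_zero] at h2
    have h3 : polarWeight q d (d + 1) = 0 := by rw [polarWeight, gaussBinom_succ_self, mul_zero]
    rw [h3, add_zero] at h2
    linarith

theorem prod_Icc_pow_add_one {R : Type*} [CommSemiring R] (a : R) (d : ℕ) :
    ∏ i ∈ Finset.Icc 1 d, (a ^ (d - i) + 1) = ∏ j ∈ Finset.range d, (a ^ j + 1) := by
  rw [← Finset.prod_range_reflect, Finset.range_eq_Ico, Finset.prod_Ico_eq_prod_range,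
    ← Finset.Ico_add_one_right_eq_Icc, Finset.prod_Ico_eq_prod_range]
  simp [Nat.sub_sub]

theorem wdCoeff_eq (hq : 2 ≤ q) {n : ℕ} (hn : 2 * d ≤ n) {i : ℕ} (hi : i ≤ d) :
    wdCoeff (fun i => (gaussNum q d - gaussNum q i) * (gaussNum q (n + 1 - d) - gaussNum q (i + 1)))
      (fun i => gaussNum q i ^ 2) (-gaussNum q d) i = (-1) ^ i * polarWeight q d i := by
  have hle : ∀ {i j}, i ≤ j → gaussNum q i ≤ gaussNum q j :=
    fun h => (gaussNum_strictMono hq).monotone h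
  induction i using Nat.twoStepInduction with
  | zero => simp [wdCoeff, polarWeight_zero]
  | one =>
    have := polarWeight_succ_mul (d := d) hq (i := 0) (by omega)
    simp only [zero_add, gaussNum_one, gaussNum_zero, polarWeight_zero] at this
    simp only [wdCoeff]
    push_cast at this ⊢
    linarith
  | more i h0 h1 =>
    have h2 := polarWeight_succ_mul hq (show i ≤ d by omega)
    have h3 := polarWeight_succ_mul hq (show i + 1 ≤ d by omega)
    have hne : (gaussNum q (i + 2) : ℝ) ≠ 0 := by
      exact_mod_cast (gaussNum_pos hq (Nat.succ_pos _)).ne'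
    rw [wdCoeff, h0 (by omega), h1 (by omega)]
    -- The coefficients use truncated subtraction; these inequalities make it genuine before casting
    -- to `ℝ`.
    push_cast [hle (show 0 ≤ d by omega), hle (show i ≤ d by omega), hle (show i + 1 ≤ d by omega),
      hle (show i + 1 ≤ n + 1 - d by omega), hle (show i + 1 + 1 ≤ n + 1 - d by omega),
      hle (show 0 + 1 ≤ n + 1 - d by omega)]
    simp only [gaussNum_one, gaussNum_zero, Nat.cast_one, Nat.cast_zero, sub_zero]
    rw [div_eq_iff (pow_ne_zero 2 hne)]
    simp only [add_assoc, Nat.reduceAdd] at *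
    rw [pow_add, pow_add]
    -- Two consecutive two-term relations express everything through the weight of index `i + 1`;
    -- the dependence on `n` then cancels.
    linear_combination (-1) ^ i * ((gaussNum q (n + 1 - d) - gaussNum q (i + 1))) * h2 -
      (-1) ^ i * gaussNum q (i + 2) * h3

theorem wdBound_eq (hq : 2 ≤ q) {n : ℕ} (hn : 2 * d ≤ n) :
    wdBound d
      (fun i => (gaussNum q d - gaussNum q i) * (gaussNum q (n + 1 - d) - gaussNum q (i + 1)))
      (fun i => gaussNum q i ^ 2) (-gaussNum q d) = ∏ j ∈ Finset.range d, ((q : ℝ) ^ j + 1) := by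
  rw [wdBound, prod_range_pow_add_one hq]
  refine Finset.sum_congr rfl fun i hi => ?_
  have hi' : i ≤ d := by simpa [Nat.lt_succ_iff] using hi
  rw [wdCoeff_eq hq hn hi', abs_mul, abs_pow, abs_neg, abs_one, one_pow, one_mul,
    abs_of_pos (polarWeight_pos hq hi')]

end GaussBinomial

/-! ### Sphere sums of a bitrade and the lower bound. -/

section Bitrades

variable {F V : Type*} [Field F] [AddCommGroup V] [Module F V] [Finite F] [FiniteDimensional F V]
  {d : ℕ}

open Module Classical

noncomputable instance : Fintype (GrassmannVertex F V d) := Fintype.ofFinite _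

/-- The sum of `f` over the vertices at distance `i` from `x`. -/
noncomputable def sphereSum (f : GrassmannVertex F V d → ℝ) (x : GrassmannVertex F V d) (i : ℕ) :
    ℝ := ∑ z with grassmannGauge x z = i, f z

theorem sum_bitradeFun {α : Type*} [Fintype α] (T₀ T₁ : Set α) (p : α → Prop)
    [DecidablePred p] :
    ∑ z with p z, bitradeFun T₀ T₁ z =
      (({z | p z} ∩ T₀).ncard : ℝ) - ({z | p z} ∩ T₁).ncard := by
  have h : ∀ T : Set α, ∑ z with p z, T.indicator (1 : α → ℝ) z = (({z | p z} ∩ T).ncard : ℝ) := by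
    intro T
    simp only [Set.indicator_apply, Pi.one_apply]
    rw [← Finset.sum_filter, Finset.filter_filter, Finset.sum_const, nsmul_one,
      Set.ncard_eq_toFinset_card']
    congr 2
    ext z
    simp
  simp [bitradeFun, Finset.sum_sub_distrib, h]

theorem IsCliqueBitrade.symm {α : Type*} {S : Set (Set α)} {T₀ T₁ : Set α}
    (h : IsCliqueBitrade S T₀ T₁) : IsCliqueBitrade S T₁ T₀ where
  disjoint := h.disjoint.symm
  nonempty_left := h.nonempty_right
  nonempty_right := h.nonempty_left
  meets C hC := (h.meets C hC).imp And.symm And.symm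

theorem IsSteinerBitrade.sum_eq_zero {T₀ T₁ : Set (GrassmannVertex F V d)}
    (h : IsSteinerBitrade F V d T₀ T₁) (U : Submodule F V) (hU : finrank F U + 1 = d) :
    ∑ z : GrassmannVertex F V d with U ≤ z.1, bitradeFun T₀ T₁ z = 0 := by
  rw [sum_bitradeFun]
  rcases h.meets _ ⟨U, hU, rfl⟩ with h | h <;> simp [h.1, h.2]

/-- The neighbours of `x` split into `[d]` cliques with `x` removed, each contributing `-f x`. -/
theorem sum_neighbors_eq {f : GrassmannVertex F V d → ℝ}
    (hf : ∀ U : Submodule F V, finrank F U + 1 = d →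
      ∑ z : GrassmannVertex F V d with U ≤ z.1, f z = 0) (x : GrassmannVertex F V d) :
    ∑ᶠ y ∈ (grassmannGraph F V d).neighborSet x, f y = -gaussNum (Nat.card F) d * f x := by
  have := Fintype.ofFinite (Submodule F V)
  rw [finsum_mem_eq_finite_toFinset_sum f (Set.toFinite _),
    ← Finset.sum_fiberwise_of_maps_to (g := fun z => x.1 ⊓ z.1)
      (t := {U : Submodule F V | U ≤ x.1 ∧ finrank F U + 1 = d})]
  · rw [Finset.sum_congr rfl (g := fun _ => - f x), Finset.sum_const, ← ncard_hyperplanes_all x,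
      Set.ncard_eq_toFinset_card']
    · simp
    · intro U hU
      obtain ⟨hUx, hU⟩ : U ≤ x.1 ∧ finrank F U + 1 = d := by simpa using hU
      have h := hf U hU
      rw [← Finset.add_sum_erase _ _ (a := x) (by simpa using hUx)] at h
      rw [← eq_neg_of_add_eq_zero_right h]
      refine Finset.sum_congr ?_ fun _ _ => rfl
      ext z
      simp only [Finset.mem_filter, Set.Finite.mem_toFinset, SimpleGraph.mem_neighborSet,
        Finset.mem_erase, Finset.mem_univ, true_and]
      constructor
      · rintro ⟨hadj, rfl⟩
        exact ⟨hadj.ne', inf_le_right⟩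
      · rintro ⟨hne, hz⟩
        exact ⟨grassmannGraph_adj_of_le hU hUx hz hne.symm, inf_eq_of_ne hU hUx hz hne.symm⟩
  · intro z hz
    have hz : (grassmannGraph F V d).Adj x z := by simpa using hz
    simpa using hz.2

theorem IsSteinerBitrade.isEigenfunction {T₀ T₁ : Set (GrassmannVertex F V d)}
    (h : IsSteinerBitrade F V d T₀ T₁) :
    IsEigenfunction (grassmannGraph F V d) (bitradeFun T₀ T₁) (-gaussNum (Nat.card F) d) := by
  refine ⟨fun h0 => ?_, sum_neighbors_eq h.sum_eq_zero⟩
  obtain ⟨x, hx⟩ := h.nonempty_left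
  have hx1 := Set.disjoint_left.1 h.disjoint hx
  have := congrFun h0 x
  simp [bitradeFun, hx, hx1] at this

theorem sphereSum_zero (f : GrassmannVertex F V d → ℝ) (x : GrassmannVertex F V d) :
    sphereSum f x 0 = f x := by
  simp only [sphereSum, grassmannGauge_eq_zero_iff]
  rw [Finset.filter_eq]
  simp

/-- The multiplicity of `z` in the double count: only spheres `i` and `i + 1` contribute, according
to whether `U` cuts `z ∩ x` down or contains it. -/
theorem ncard_hyperplanes_inf_eq (x z : GrassmannVertex F V d) (i : ℕ) :
    {U : Submodule F V | (U ≤ z.1 ∧ finrank F U + 1 = d) ∧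
      finrank F (U ⊓ x.1 : Submodule F V) + (i + 1) = d}.ncard =
      if grassmannGauge x z = i + 1 then gaussNum (Nat.card F) (i + 1) else
      if grassmannGauge x z = i then gaussNum (Nat.card F) d - gaussNum (Nat.card F) i else 0 := by
  have hz := finrank_inf_le_vertex x.1 z
  have hU : ∀ U : Submodule F V, U ≤ z.1 ∧ finrank F U + 1 = d → _ :=
    fun U h => finrank_inf_hyperplane h.2 x.1 h.1
  split_ifs with h1 h2
  · rw [← h1, grassmannGauge, ← ncard_hyperplanes_ge]
    rw [grassmannGauge] at h1
    congr 1
    ext U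
    refine and_congr_right fun h => ?_
    rcases hU U h with k | k <;> simp only [k.1, iff_true, iff_false] <;> omega
  · rw [← h2, grassmannGauge, ← ncard_hyperplanes_not_ge]
    rw [grassmannGauge] at h2
    congr 1
    ext U
    refine and_congr_right fun h => ?_
    rcases hU U h with k | k <;> simp only [k.1, not_true, not_false_iff] <;>
      simp only [iff_true, iff_false] <;> omega
  · rw [grassmannGauge] at h1 h2
    rw [Set.ncard_eq_zero (Set.toFinite _), Set.eq_empty_iff_forall_notMem]
    rintro U ⟨h, h3⟩
    rcases hU U h with k | k <;> omega

theorem sphereSum_succ {f : GrassmannVertex F V d → ℝ}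
    (hf : ∀ U : Submodule F V, finrank F U + 1 = d →
      ∑ z : GrassmannVertex F V d with U ≤ z.1, f z = 0) (x : GrassmannVertex F V d)
    {i : ℕ} (hi : i < d) :
    (gaussNum (Nat.card F) (i + 1) : ℝ) * sphereSum f x (i + 1) =
      -((gaussNum (Nat.card F) d - gaussNum (Nat.card F) i) * sphereSum f x i) := by
  have := Fintype.ofFinite (Submodule F V)
  have hq : 2 ≤ Nat.card F := Finite.one_lt_card
  have h : ∑ U ∈ ({U : Submodule F V | finrank F U + 1 = d ∧
      finrank F (U ⊓ x.1 : Submodule F V) + (i + 1) = d} : Finset (Submodule F V)),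
      ∑ z : GrassmannVertex F V d with U ≤ z.1, f z = 0 :=
    Finset.sum_eq_zero fun U hU => hf U (Finset.mem_filter.1 hU).2.1
  rw [Finset.sum_comm' (t' := Finset.univ)
    (s' := fun z => {U : Submodule F V | (U ≤ z.1 ∧ finrank F U + 1 = d) ∧
      finrank F (U ⊓ x.1 : Submodule F V) + (i + 1) = d})
    (by intro U z; simp; tauto)] at h
  simp only [Finset.sum_const, nsmul_eq_mul] at h
  have hN : ∀ z : GrassmannVertex F V d, ((({U : Submodule F V | (U ≤ z.1 ∧ finrank F U + 1 = d) ∧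
      finrank F (U ⊓ x.1 : Submodule F V) + (i + 1) = d} : Finset _).card : ℕ) : ℝ) * f z =
      gaussNum (Nat.card F) (i + 1) * (if grassmannGauge x z = i + 1 then f z else 0) +
      (gaussNum (Nat.card F) d - gaussNum (Nat.card F) i) *
        (if grassmannGauge x z = i then f z else 0) := by
    intro z
    have h1 := ncard_hyperplanes_inf_eq x z i
    rw [Set.ncard_eq_toFinset_card', Set.toFinset_ofPred] at h1
    rw [h1]
    have hle := (gaussNum_strictMono hq).monotone hi.le
    split_ifs with h2 h3 <;> first | omega | (push_cast [hle]; ring)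
  rw [Finset.sum_congr rfl fun z _ => hN z, Finset.sum_add_distrib, ← Finset.mul_sum,
    ← Finset.mul_sum, ← Finset.sum_filter, ← Finset.sum_filter] at h
  exact eq_neg_of_add_eq_zero_left h

theorem sphereSum_eq {f : GrassmannVertex F V d → ℝ}
    (hf : ∀ U : Submodule F V, finrank F U + 1 = d →
      ∑ z : GrassmannVertex F V d with U ≤ z.1, f z = 0) (x : GrassmannVertex F V d)
    {i : ℕ} (hi : i ≤ d) :
    sphereSum f x i = (-1) ^ i * polarWeight (Nat.card F) d i * f x := by
  have hq : 2 ≤ Nat.card F := Finite.one_lt_card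
  induction i with
  | zero => simp [sphereSum_zero, polarWeight_zero]
  | succ i ih =>
    have hne : (gaussNum (Nat.card F) (i + 1) : ℝ) ≠ 0 := by
      exact_mod_cast (gaussNum_pos hq (Nat.succ_pos _)).ne'
    apply mul_left_cancel₀ hne
    rw [sphereSum_succ hf x hi, ih (by omega), pow_succ]
    linear_combination (-1) ^ i * f x * polarWeight_succ_mul hq (show i ≤ d by omega)

theorem ncard_union_eq_sum {T₀ T₁ : Set (GrassmannVertex F V d)} (h : Disjoint T₀ T₁)
    (x : GrassmannVertex F V d) :
    (T₀ ∪ T₁).ncard = ∑ i ∈ Finset.range (d + 1),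
      (({z | grassmannGauge x z = i} ∩ T₀).ncard + ({z | grassmannGauge x z = i} ∩ T₁).ncard) := by
  rw [Set.ncard_union_eq h, Finset.sum_add_distrib]
  have : ∀ T : Set (GrassmannVertex F V d),
      T.ncard = ∑ i ∈ Finset.range (d + 1), ({z | grassmannGauge x z = i} ∩ T).ncard := by
    intro T
    rw [Set.ncard_eq_toFinset_card', Finset.card_eq_sum_card_fiberwise (f := grassmannGauge x)
      (t := Finset.range (d + 1)) (fun z _ => by simp [grassmannGauge])]
    refine Finset.sum_congr rfl fun i _ => ?_
    rw [Set.ncard_eq_toFinset_card']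
    congr 1
    ext z
    simp [and_comm]
  rw [← this, ← this]

theorem IsSteinerBitrade.ncard_sphere_sub {T₀ T₁ : Set (GrassmannVertex F V d)}
    (h : IsSteinerBitrade F V d T₀ T₁) {x : GrassmannVertex F V d} (hx : x ∈ T₀) {i : ℕ}
    (hi : i ≤ d) :
    (({z | grassmannGauge x z = i} ∩ T₀).ncard : ℝ) - ({z | grassmannGauge x z = i} ∩ T₁).ncard =
      (-1) ^ i * polarWeight (Nat.card F) d i := by
  have hx1 := Set.disjoint_left.1 h.disjoint hx
  have := sphereSum_eq h.sum_eq_zero x hi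
  rw [sphereSum, sum_bitradeFun] at this
  simpa [bitradeFun, hx, hx1] using this

theorem IsSteinerBitrade.polarWeight_le {T₀ T₁ : Set (GrassmannVertex F V d)}
    (h : IsSteinerBitrade F V d T₀ T₁) {x : GrassmannVertex F V d} (hx : x ∈ T₀) {i : ℕ}
    (hi : i ≤ d) :
    polarWeight (Nat.card F) d i ≤ ({z | grassmannGauge x z = i} ∩ T₀).ncard +
      ({z | grassmannGauge x z = i} ∩ T₁).ncard := by
  have h1 := h.ncard_sphere_sub hx hi
  have h2 : (0 : ℝ) ≤ ({z | grassmannGauge x z = i} ∩ T₀).ncard := Nat.cast_nonneg _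
  have h3 : (0 : ℝ) ≤ ({z | grassmannGauge x z = i} ∩ T₁).ncard := Nat.cast_nonneg _
  rcases neg_one_pow_eq_or ℝ i with h4 | h4 <;> rw [h4] at h1 <;> linarith

theorem cast_prod_pow_add_one (q d : ℕ) :
    ((∏ j ∈ Finset.range d, (q ^ j + 1) : ℕ) : ℝ) = ∏ j ∈ Finset.range d, ((q : ℝ) ^ j + 1) := by
  push_cast
  rfl

theorem IsSteinerBitrade.le_ncard {T₀ T₁ : Set (GrassmannVertex F V d)}
    (h : IsSteinerBitrade F V d T₀ T₁) :
    ∏ j ∈ Finset.range d, (Nat.card F ^ j + 1) ≤ (T₀ ∪ T₁).ncard := by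
  obtain ⟨x, hx⟩ := h.nonempty_left
  rw [← Nat.cast_le (α := ℝ), cast_prod_pow_add_one, prod_range_pow_add_one Finite.one_lt_card,
    ncard_union_eq_sum h.disjoint x]
  push_cast
  exact Finset.sum_le_sum fun i hi => h.polarWeight_le hx (by simpa [Nat.lt_succ_iff] using hi)

/-- Termwise bounds whose sums agree must all be equalities. -/
theorem IsSteinerBitrade.ncard_sphere_add {T₀ T₁ : Set (GrassmannVertex F V d)}
    (h : IsSteinerBitrade F V d T₀ T₁) {x : GrassmannVertex F V d} (hx : x ∈ T₀)
    (hcard : (T₀ ∪ T₁).ncard = ∏ j ∈ Finset.range d, (Nat.card F ^ j + 1)) {i : ℕ} (hi : i ≤ d) :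
    polarWeight (Nat.card F) d i = ({z | grassmannGauge x z = i} ∩ T₀).ncard +
      ({z | grassmannGauge x z = i} ∩ T₁).ncard := by
  rw [ncard_union_eq_sum h.disjoint x, ← Nat.cast_inj (R := ℝ), cast_prod_pow_add_one,
    prod_range_pow_add_one Finite.one_lt_card] at hcard
  push_cast at hcard
  exact (Finset.sum_eq_sum_iff_of_le fun i hi =>
    h.polarWeight_le hx (by simpa [Nat.lt_succ_iff] using hi)).1 hcard.symm i
      (by simpa [Nat.lt_succ_iff] using hi)

/-- On each sphere the sum and the signed difference of the two counts now agree up to sign, so one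
of the counts vanishes. -/
theorem IsSteinerBitrade.even_gauge_iff {T₀ T₁ : Set (GrassmannVertex F V d)}
    (h : IsSteinerBitrade F V d T₀ T₁)
    (hcard : (T₀ ∪ T₁).ncard = ∏ j ∈ Finset.range d, (Nat.card F ^ j + 1))
    {x y : GrassmannVertex F V d} (hx : x ∈ T₀) (hy : y ∈ T₀ ∪ T₁) :
    Even (grassmannGauge x y) ↔ y ∈ T₀ := by
  have hi : grassmannGauge x y ≤ d := Nat.sub_le _ _
  have h1 := h.ncard_sphere_sub hx hi
  rw [h.ncard_sphere_add hx hcard hi] at h1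
  rcases Nat.even_or_odd (grassmannGauge x y) with he | ho
  · simp only [he, true_iff]
    rw [he.neg_one_pow] at h1
    have h2 : (({z | grassmannGauge x z = grassmannGauge x y} ∩ T₁).ncard : ℝ) = 0 := by linarith
    rw [Nat.cast_eq_zero, Set.ncard_eq_zero (Set.toFinite _)] at h2
    exact hy.resolve_right fun hy => (h2.subset ⟨rfl, hy⟩).elim
  · simp only [Nat.not_even_iff_odd.2 ho, false_iff]
    rw [ho.neg_one_pow] at h1
    have h2 : (({z | grassmannGauge x z = grassmannGauge x y} ∩ T₀).ncard : ℝ) = 0 := by linarith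
    rw [Nat.cast_eq_zero, Set.ncard_eq_zero (Set.toFinite _)] at h2
    exact fun hy => (h2.subset ⟨rfl, hy⟩).elim

theorem IsSteinerBitrade.ncard_of_even_iff {T₀ T₁ : Set (GrassmannVertex F V d)}
    (h : IsSteinerBitrade F V d T₀ T₁) {x : GrassmannVertex F V d} (hx : x ∈ T₀)
    (hT : ∀ y ∈ T₀ ∪ T₁, Even (grassmannGauge x y) ↔ y ∈ T₀) :
    (T₀ ∪ T₁).ncard = ∏ j ∈ Finset.range d, (Nat.card F ^ j + 1) := by
  rw [← Nat.cast_inj (R := ℝ), cast_prod_pow_add_one, prod_range_pow_add_one Finite.one_lt_card,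
    ncard_union_eq_sum h.disjoint x]
  push_cast
  refine Finset.sum_congr rfl fun i hi => ?_
  have h1 := h.ncard_sphere_sub hx (i := i) (by simpa [Nat.lt_succ_iff] using hi)
  rcases Nat.even_or_odd i with he | ho
  · have h2 : {z | grassmannGauge x z = i} ∩ T₁ = ∅ := by
      refine Set.eq_empty_iff_forall_notMem.2 fun z ⟨hz, hz1⟩ => ?_
      exact Set.disjoint_left.1 h.disjoint ((hT z (.inr hz1)).1 (hz ▸ he)) hz1
    rw [he.neg_one_pow] at h1
    simp only [h2, Set.ncard_empty, Nat.cast_zero] at h1 ⊢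
    linarith
  · have h2 : {z | grassmannGauge x z = i} ∩ T₀ = ∅ := by
      refine Set.eq_empty_iff_forall_notMem.2 fun z ⟨hz, hz1⟩ => ?_
      exact Nat.not_even_iff_odd.2 ho (hz ▸ (hT z (.inl hz1)).2 hz1)
    rw [ho.neg_one_pow] at h1
    simp only [h2, Set.ncard_empty, Nat.cast_zero] at h1 ⊢
    linarith

end Bitrades

/-! ### Thin families: distance-regularity, and bitrades from parity. -/

section ThinFamilies

variable {F V : Type*} [Field F] [AddCommGroup V] [Module F V] {d : ℕ} {α : Type*}

open Module

/-- A thin family of `d`-dimensional subspaces: every hyperplane of a member lies in another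
member, and whenever two members share a hyperplane `U`, every member meets exactly one of the two
outside `U`. -/
structure IsThinFamily (v : α → GrassmannVertex F V d) : Prop where
  injective : Function.Injective v
  exists_other : ∀ a (U : Submodule F V), finrank F U + 1 = d → U ≤ (v a).1 →
    ∃ b, b ≠ a ∧ U ≤ (v b).1
  gate : ∀ a b x (U : Submodule F V), a ≠ b → finrank F U + 1 = d → U ≤ (v a).1 → U ≤ (v b).1 →
    ((v a).1 ⊓ (v x).1 ≤ U ↔ ¬ (v b).1 ⊓ (v x).1 ≤ U)

namespace IsThinFamily

variable {v : α → GrassmannVertex F V d}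

/-- At most two members contain a given `U`: for three of them, `gate` at `x = a` would make three
propositions pairwise opposite. -/
theorem eq_of_ne (hv : IsThinFamily v) {a b c : α} {U : Submodule F V} (hU : finrank F U + 1 = d)
    (ha : U ≤ (v a).1) (hb : U ≤ (v b).1) (hc : U ≤ (v c).1) (hab : b ≠ a) (hac : c ≠ a) :
    b = c := by
  by_contra hbc
  have h1 := hv.gate a b a U hab.symm hU ha hb
  have h2 := hv.gate a c a U hac.symm hU ha hc
  have h3 := hv.gate b c a U hbc hU hb hc
  tauto

theorem map (hv : IsThinFamily v) {E : Type*} [AddCommGroup E] [Module F E] (f : V →ₗ[F] E)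
    (hf : Function.Injective f) {w : α → GrassmannVertex F E d}
    (hw : ∀ a, (w a).1 = (v a).1.map f) : IsThinFamily w := by
  have hfin : ∀ U : Submodule F V, finrank F (U.map f) = finrank F U := fun U =>
    (Submodule.equivMapOfInjective f hf U).finrank_eq.symm
  have hle : ∀ {A B : Submodule F V}, A.map f ≤ B.map f ↔ A ≤ B :=
    Submodule.map_le_map_iff_of_injective hf _ _
  have hU : ∀ a (U : Submodule F E), U ≤ (w a).1 → ∃ U', U = Submodule.map f U' := by
    intro a U h
    rw [hw] at h
    exact ⟨U.comap f, (Submodule.map_comap_eq_of_le (h.trans LinearMap.map_le_range)).symm⟩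
  refine ⟨fun a b h => hv.injective (Subtype.ext ?_), ?_, ?_⟩
  · have h1 : (w a).1 = (w b).1 := congrArg Subtype.val h
    rw [hw, hw] at h1
    exact Submodule.map_injective_of_injective hf h1
  · intro a U hUd hUa
    obtain ⟨U, rfl⟩ := hU a U hUa
    rw [hw, hle] at hUa
    rw [hfin] at hUd
    obtain ⟨b, hba, hb⟩ := hv.exists_other a U hUd hUa
    exact ⟨b, hba, by rwa [hw, hle]⟩
  · intro a b x U hab hUd hUa hUb
    obtain ⟨U, rfl⟩ := hU a U hUa
    rw [hw, hle] at hUa hUb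
    rw [hfin] at hUd
    rw [hw, hw, hw, ← Submodule.map_inf f hf, ← Submodule.map_inf f hf, hle, hle]
    exact hv.gate a b x U hab hUd hUa hUb

variable [FiniteDimensional F V]

theorem even_gauge_iff (hv : IsThinFamily v) {a b : α} {U : Submodule F V} (hab : a ≠ b)
    (hU : finrank F U + 1 = d) (ha : U ≤ (v a).1) (hb : U ≤ (v b).1) (x : α) :
    Even (grassmannGauge (v x) (v a)) ↔ ¬ Even (grassmannGauge (v x) (v b)) := by
  have h := hv.gate a b x U hab hU ha hb
  have hadj := grassmannGraph_adj_of_le hU ha hb (hv.injective.ne hab)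
  have hi := inf_eq_of_ne hU ha hb (hv.injective.ne hab)
  have h1 := grassmannGauge_eq_succ_iff (v x) hadj
  have h2 := grassmannGauge_succ_eq_iff (v x) hadj
  rw [hi] at h1 h2
  by_cases h3 : (v a).1 ⊓ (v x).1 ≤ U
  · rw [← h2.2 ⟨h3, h.1 h3⟩, Nat.even_add_one]
  · rw [h1.2 ⟨h3, by tauto⟩, Nat.even_add_one, not_not]

theorem ncard_neighbors (hv : IsThinFamily v) (a : α) (P : Submodule F V → Prop) :
    {b | (grassmannGraph F V d).Adj (v a) (v b) ∧ P ((v a).1 ⊓ (v b).1)}.ncard =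
      {U : Submodule F V | (U ≤ (v a).1 ∧ finrank F U + 1 = d) ∧ P U}.ncard := by
  refine Set.ncard_congr (fun b _ => (v a).1 ⊓ (v b).1) ?_ ?_ ?_
  · rintro b ⟨hb, hP⟩
    exact ⟨⟨inf_le_left, hb.2⟩, hP⟩
  · rintro b c ⟨hb, -⟩ ⟨hc, -⟩ h
    refine hv.eq_of_ne hb.2 inf_le_left inf_le_right ?_ ?_ ?_
    · have h : (v a).1 ⊓ (v b).1 = (v a).1 ⊓ (v c).1 := h
      exact h.le.trans inf_le_right
    · exact fun h => hb.1 (h ▸ rfl)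
    · exact fun h => hc.1 (h ▸ rfl)
  · rintro U ⟨⟨hUa, hU⟩, hP⟩
    obtain ⟨b, hba, hUb⟩ := hv.exists_other a U hU hUa
    have hi := inf_eq_of_ne hU hUa hUb (hv.injective.ne hba.symm)
    exact ⟨b, ⟨grassmannGraph_adj_of_le hU hUa hUb (hv.injective.ne hba.symm), hi.symm ▸ hP⟩, hi⟩

variable [Finite F]

/-- By `gate`, whether the neighbour across `U` is nearer or farther depends only on whether `U`
contains `y ∩ x`. -/
theorem isDistanceRegularWith (hv : IsThinFamily v) [Nonempty α] :
    IsDistanceRegularWith ((grassmannGraph F V d).comap v) d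
      (fun i => gaussNum (Nat.card F) d - gaussNum (Nat.card F) i)
      (fun i => gaussNum (Nat.card F) i) := by
  have hq : 2 ≤ Nat.card F := Finite.one_lt_card
  refine isDistanceRegularWith_of_gauge (δ := fun x y => grassmannGauge (v x) (v y))
    (fun x y => grassmannGauge_eq_zero_iff.trans hv.injective.eq_iff)
    (fun x y z h => grassmannGauge_le_succ (v x) h) (fun x y => Nat.sub_le _ _)
    (fun x y => ?_) (fun x y => ?_) (fun i hi => Nat.sub_pos_of_lt (gaussNum_strictMono hq hi))
    (fun i hi _ => gaussNum_pos hq hi)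
  · rw [grassmannGauge, ← ncard_hyperplanes_not_ge,
      ← hv.ncard_neighbors y (fun U => ¬ (v y).1 ⊓ (v x).1 ≤ U)]
    congr 1
    ext z
    refine and_congr_right fun hz => ?_
    have hz : (grassmannGraph F V d).Adj (v y) (v z) := hz
    have h := hv.gate y z x _ (fun h => hz.1 (h ▸ rfl)) hz.2 inf_le_left inf_le_right
    rw [← grassmannGauge, grassmannGauge_eq_succ_iff (v x) hz]
    tauto
  · rw [grassmannGauge, ← ncard_hyperplanes_ge,
      ← hv.ncard_neighbors y (fun U => (v y).1 ⊓ (v x).1 ≤ U)]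
    congr 1
    ext z
    refine and_congr_right fun hz => ?_
    have hz : (grassmannGraph F V d).Adj (v y) (v z) := hz
    have h := hv.gate y z x _ (fun h => hz.1 (h ▸ rfl)) hz.2 inf_le_left inf_le_right
    rw [← grassmannGauge, grassmannGauge_succ_eq_iff (v x) hz]
    tauto

theorem isSteinerBitrade (hv : IsThinFamily v) (hd : 1 ≤ d) (x : α) :
    IsSteinerBitrade F V d (v '' {a | Even (grassmannGauge (v x) (v a))})
      (v '' {a | ¬ Even (grassmannGauge (v x) (v a))}) := by
  have hother : ∀ (a b : α) (U : Submodule F V), finrank F U + 1 = d → U ≤ (v a).1 →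
      U ≤ (v b).1 → b ≠ a → Even (grassmannGauge (v x) (v a)) →
      ({W | U ≤ W.1} ∩ v '' {a | Even (grassmannGauge (v x) (v a))}).ncard = 1 ∧
      ({W | U ≤ W.1} ∩ v '' {a | ¬ Even (grassmannGauge (v x) (v a))}).ncard = 1 := by
    intro a b U hU ha hb hba he
    have hob := (hv.even_gauge_iff hba.symm hU ha hb x).1 he
    rw [Set.ncard_eq_one, Set.ncard_eq_one]
    refine ⟨⟨v a, Set.eq_singleton_iff_unique_mem.2 ⟨⟨ha, a, he, rfl⟩, ?_⟩⟩,
      ⟨v b, Set.eq_singleton_iff_unique_mem.2 ⟨⟨hb, b, hob, rfl⟩, ?_⟩⟩⟩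
    · rintro _ ⟨hc, c, hce, rfl⟩
      by_contra hne
      obtain rfl := hv.eq_of_ne hU ha hb hc hba fun h => hne (h ▸ rfl)
      exact hob hce
    · rintro _ ⟨hc, c, hce, rfl⟩
      by_contra hne
      obtain rfl := hv.eq_of_ne hU hb ha hc hba.symm fun h => hne (h ▸ rfl)
      exact hce he
  refine ⟨?_, ⟨_, x, ?_, rfl⟩, ?_, ?_⟩
  · refine Set.disjoint_image_of_injective hv.injective ?_
    exact Set.disjoint_left.2 fun a h1 h2 => h2 h1
  · simp [grassmannGauge_eq_zero_iff.2 rfl]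
  · have h := ncard_hyperplanes_all (v x)
    have h0 := gaussNum_pos (q := Nat.card F) Finite.one_lt_card hd
    rw [← h] at h0
    obtain ⟨U, hUx, hU⟩ := Set.nonempty_of_ncard_ne_zero h0.ne'
    obtain ⟨b, hb, hUb⟩ := hv.exists_other x U hU hUx
    refine ⟨_, b, (hv.even_gauge_iff hb.symm hU hUx hUb x).1 ?_, rfl⟩
    simp [grassmannGauge_eq_zero_iff.2 rfl]
  · rintro C ⟨U, hU, rfl⟩
    by_cases h : ∃ a, U ≤ (v a).1
    · obtain ⟨a, ha⟩ := h
      obtain ⟨b, hba, hb⟩ := hv.exists_other a U hU ha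
      left
      by_cases he : Even (grassmannGauge (v x) (v a))
      · exact hother a b U hU ha hb hba he
      · refine hother b a U hU hb ha hba.symm ?_
        rwa [hv.even_gauge_iff hba hU hb ha x]
    · right
      constructor <;>
      · refine Set.eq_empty_iff_forall_notMem.2 ?_
        rintro _ ⟨hW, a, -, rfl⟩
        exact h ⟨a, hW⟩

theorem exists_isSteinerBitrade (hv : IsThinFamily v) [Nonempty α] (hd : 1 ≤ d) :
    ∃ T₀ T₁ : Set (GrassmannVertex F V d), IsSteinerBitrade F V d T₀ T₁ ∧
      (T₀ ∪ T₁).ncard = ∏ j ∈ Finset.range d, (Nat.card F ^ j + 1) := by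
  obtain ⟨x⟩ := ‹Nonempty α›
  have hx : Even (grassmannGauge (v x) (v x)) := by simp [grassmannGauge_eq_zero_iff.2 rfl]
  refine ⟨_, _, hv.isSteinerBitrade hd x,
    (hv.isSteinerBitrade hd x).ncard_of_even_iff ⟨x, hx, rfl⟩ ?_⟩
  rintro _ (⟨a, ha, rfl⟩ | ⟨a, ha, rfl⟩)
  · exact ⟨fun h => ⟨a, h, rfl⟩, fun _ => ha⟩
  · exact ⟨fun h => ⟨a, h, rfl⟩, by
      rintro ⟨b, hb, hba⟩
      exact hba ▸ hb⟩

end IsThinFamily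

/-! ### Bitrades of minimum cardinality are thin families. -/

section Minimum

variable {T₀ T₁ : Set (GrassmannVertex F V d)}

theorem IsCliqueBitrade.mem_iff_notMem {β : Type*} {S : Set (Set β)} {R₀ R₁ : Set β}
    (h : IsCliqueBitrade S R₀ R₁) {C : Set β} (hC : C ∈ S) {a b : β} (ha : a ∈ C) (hb : b ∈ C)
    (haT : a ∈ R₀ ∪ R₁) (hbT : b ∈ R₀ ∪ R₁) (hab : a ≠ b) : a ∈ R₀ ↔ b ∉ R₀ := by
  rcases h.meets C hC with ⟨h0, h1⟩ | ⟨h0, h1⟩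
  · obtain ⟨u, hu⟩ := Set.ncard_eq_one.1 h0
    obtain ⟨w, hw⟩ := Set.ncard_eq_one.1 h1
    constructor
    · intro ha0 hb0
      exact hab ((hu.subset ⟨ha, ha0⟩ : a = u).trans (hu.subset ⟨hb, hb0⟩ : b = u).symm)
    · intro hb0
      by_contra ha0
      exact hab ((hw.subset ⟨ha, haT.resolve_left ha0⟩ : a = w).trans
        (hw.subset ⟨hb, hbT.resolve_left hb0⟩ : b = w).symm)
  · rcases haT with ha0 | ha1
    · exact (h0.subset ⟨ha, ha0⟩).elim
    · exact (h1.subset ⟨ha, ha1⟩).elim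

theorem IsSteinerBitrade.isBipartiteWith (h : IsSteinerBitrade F V d T₀ T₁) :
    ((grassmannGraph F V d).induce (T₀ ∪ T₁)).IsBipartiteWith
      (Subtype.val ⁻¹' T₀) (Subtype.val ⁻¹' T₁) where
  disjoint := h.disjoint.preimage _
  mem_of_adj := by
    rintro ⟨a, ha⟩ ⟨b, hb⟩ hab
    have hab : (grassmannGraph F V d).Adj a b := hab
    have h1 := IsCliqueBitrade.mem_iff_notMem h ⟨_, hab.2, rfl⟩ (Set.mem_ofPred.2 inf_le_left)
      (Set.mem_ofPred.2 inf_le_right) ha hb hab.1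
    rcases ha with ha | ha
    · exact .inl ⟨ha, hb.resolve_left (h1.1 ha)⟩
    · refine .inr ⟨ha, ?_⟩
      by_contra hb0
      exact Set.disjoint_left.1 h.disjoint (h1.2 hb0) ha

variable [FiniteDimensional F V] [Finite F]

theorem IsSteinerBitrade.even_gauge_iff_iff (h : IsSteinerBitrade F V d T₀ T₁)
    (hcard : (T₀ ∪ T₁).ncard = ∏ j ∈ Finset.range d, (Nat.card F ^ j + 1))
    {x y : GrassmannVertex F V d} (hx : x ∈ T₀ ∪ T₁) (hy : y ∈ T₀ ∪ T₁) :
    Even (grassmannGauge x y) ↔ (x ∈ T₀ ↔ y ∈ T₀) := by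
  have hnot : ∀ z ∈ T₀ ∪ T₁, z ∈ T₁ ↔ z ∉ T₀ := fun z hz =>
    ⟨fun h1 h0 => Set.disjoint_left.1 h.disjoint h0 h1, hz.resolve_left⟩
  rcases hx with hx | hx
  · rw [h.even_gauge_iff hcard hx hy, iff_true_left hx]
  · rw [IsSteinerBitrade.even_gauge_iff (IsCliqueBitrade.symm h) (by rwa [Set.union_comm]) hx
      (by rwa [Set.union_comm]), hnot y hy, iff_false_left ((hnot x (.inr hx)).1 hx)]

theorem IsSteinerBitrade.isThinFamily (h : IsSteinerBitrade F V d T₀ T₁)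
    (hcard : (T₀ ∪ T₁).ncard = ∏ j ∈ Finset.range d, (Nat.card F ^ j + 1)) :
    IsThinFamily (Subtype.val : ↥(T₀ ∪ T₁) → GrassmannVertex F V d) := by
  refine ⟨Subtype.val_injective, ?_, ?_⟩
  · rintro ⟨a, ha⟩ U hU hUa
    rcases h.meets _ ⟨U, hU, rfl⟩ with ⟨h0, h1⟩ | ⟨h0, h1⟩
    · obtain ⟨u, hu, hu0⟩ := Set.nonempty_of_ncard_ne_zero (h0.trans_ne one_ne_zero)
      obtain ⟨w, hw, hw1⟩ := Set.nonempty_of_ncard_ne_zero (h1.trans_ne one_ne_zero)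
      have huw : u ≠ w := fun e => Set.disjoint_left.1 h.disjoint hu0 (e ▸ hw1)
      by_cases hau : a = u
      · exact ⟨⟨w, .inr hw1⟩, fun e => huw (hau.symm.trans (congrArg Subtype.val e).symm), hw⟩
      · exact ⟨⟨u, .inl hu0⟩, fun e => hau (congrArg Subtype.val e).symm, hu⟩
    · rcases ha with ha | ha
      · exact (h0.subset ⟨hUa, ha⟩).elim
      · exact (h1.subset ⟨hUa, ha⟩).elim
  · rintro ⟨a, ha⟩ ⟨b, hb⟩ ⟨x, hx⟩ U hab hU hUa hUb
    have hab : a ≠ b := fun h => hab (Subtype.ext h)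
    have h1 := IsCliqueBitrade.mem_iff_notMem h ⟨U, hU, rfl⟩ hUa hUb ha hb hab
    have h2 := h.even_gauge_iff_iff hcard hx ha
    have h3 := h.even_gauge_iff_iff hcard hx hb
    -- Equal dimensions would give equal parities, although `a` and `b` lie in opposite parts.
    have hne : finrank F (a.1 ⊓ x.1 : Submodule F V) ≠ finrank F (b.1 ⊓ x.1 : Submodule F V) := by
      intro he
      rw [grassmannGauge, he, ← grassmannGauge, h3] at h2
      tauto
    rcases finrank_inf_hyperplane hU x.1 hUa with h4 | h4 <;>
    rcases finrank_inf_hyperplane hU x.1 hUb with h5 | h5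
    · exact absurd (h4.2.trans h5.2.symm) hne
    · exact iff_of_true h4.1 h5.1
    · exact iff_of_false h4.1 (not_not.2 h5.1)
    · exact absurd (h4.2.trans h5.2.symm) hne

end Minimum

end ThinFamilies

/-! ### Maximal totally singular subspaces of the hyperbolic form. -/

section DualPolarSpace

variable {F : Type*} [Field F] {d : ℕ}

open Module

/-- The polar form of the hyperbolic quadratic form. -/
def hyperbolicPolar (F : Type*) [Field F] (d : ℕ) :
    LinearMap.BilinForm F ((Fin d → F) × (Fin d → F)) :=
  LinearMap.mk₂ F (fun p r => p.1 ⬝ᵥ r.2 + p.2 ⬝ᵥ r.1)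
    (by intros; simp only [Prod.fst_add, Prod.snd_add, add_dotProduct]; ring)
    (by intros; simp [mul_add])
    (by intros; simp only [Prod.fst_add, Prod.snd_add, dotProduct_add]; ring)
    (by intros; simp [mul_add])

theorem hyperbolicPolar_apply (p r : (Fin d → F) × (Fin d → F)) :
    hyperbolicPolar F d p r = p.1 ⬝ᵥ r.2 + p.2 ⬝ᵥ r.1 := rfl

theorem hyperbolicPolar_comm (p r : (Fin d → F) × (Fin d → F)) :
    hyperbolicPolar F d p r = hyperbolicPolar F d r p := by
  rw [hyperbolicPolar_apply, hyperbolicPolar_apply, dotProduct_comm, dotProduct_comm p.2, add_comm]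

theorem hyperbolicForm_add (p r : (Fin d → F) × (Fin d → F)) :
    hyperbolicForm F d (p + r) =
      hyperbolicForm F d p + hyperbolicForm F d r + hyperbolicPolar F d p r := by
  simp only [hyperbolicForm, hyperbolicPolar_apply, dotProduct, ← Finset.sum_add_distrib]
  refine Finset.sum_congr rfl fun i _ => ?_
  simp only [Prod.fst_add, Prod.snd_add, Pi.add_apply]
  ring

theorem hyperbolicForm_smul (t : F) (p : (Fin d → F) × (Fin d → F)) :
    hyperbolicForm F d (t • p) = t ^ 2 * hyperbolicForm F d p := by
  simp only [hyperbolicForm, Finset.mul_sum]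
  refine Finset.sum_congr rfl fun i _ => ?_
  simp only [Prod.smul_fst, Prod.smul_snd, Pi.smul_apply, smul_eq_mul]
  ring

theorem hyperbolicPolar_nondegenerate : (hyperbolicPolar F d).Nondegenerate := by
  have h : (hyperbolicPolar F d).SeparatingLeft := by
    intro p hp
    have h1 : p.1 = 0 := by
      ext i
      simpa [hyperbolicPolar_apply] using hp (0, Pi.single i 1)
    have h2 : p.2 = 0 := by
      ext i
      simpa [hyperbolicPolar_apply] using hp (Pi.single i 1, 0)
    exact Prod.ext h1 h2
  exact ⟨h, fun p hp => h p fun r => by rw [hyperbolicPolar_comm, hp]⟩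

/-- The subspaces on which the hyperbolic quadratic form vanishes. -/
def IsTotallySingular (W : Submodule F ((Fin d → F) × (Fin d → F))) : Prop :=
  ∀ p ∈ W, hyperbolicForm F d p = 0

/-- The orthogonal complement with respect to the polar form. -/
abbrev polarOrthogonal (W : Submodule F ((Fin d → F) × (Fin d → F))) :
    Submodule F ((Fin d → F) × (Fin d → F)) := (hyperbolicPolar F d).orthogonal W

theorem finrank_polarOrthogonal_add (W : Submodule F ((Fin d → F) × (Fin d → F))) :
    finrank F (polarOrthogonal W) + finrank F W = 2 * d := by
  have h : finrank F (polarOrthogonal W) = _ :=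
    LinearMap.BilinForm.finrank_orthogonal hyperbolicPolar_nondegenerate W
  have h1 := Submodule.finrank_le W
  have h2 : finrank F ((Fin d → F) × (Fin d → F)) = 2 * d := by
    simp [two_mul]
  omega

namespace IsTotallySingular

variable {A B U W X : Submodule F ((Fin d → F) × (Fin d → F))}

/-- Polarising the quadratic form, without dividing by `2`, keeps characteristic `2` included. -/
theorem polar_eq_zero (hW : IsTotallySingular W) {p r : (Fin d → F) × (Fin d → F)} (hp : p ∈ W)
    (hr : r ∈ W) : hyperbolicPolar F d p r = 0 := by
  simpa [hW p hp, hW r hr, hW _ (W.add_mem hp hr)] using (hyperbolicForm_add p r).symm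

theorem le_orthogonal (hW : IsTotallySingular W) : W ≤ polarOrthogonal W := fun _ hp _ hr =>
  hW.polar_eq_zero hr hp

theorem mono (hW : IsTotallySingular W) (h : U ≤ W) : IsTotallySingular U := fun p hp => hW p (h hp)

theorem orthogonal_eq (hW : IsTotallySingular W) (hd : finrank F W = d) :
    polarOrthogonal W = W := by
  refine (Submodule.eq_of_le_of_finrank_eq hW.le_orthogonal ?_).symm
  have := finrank_polarOrthogonal_add W
  omega

theorem sup_span (hW : IsTotallySingular W) {p : (Fin d → F) × (Fin d → F)}
    (hp : p ∈ polarOrthogonal W) (h0 : hyperbolicForm F d p = 0) :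
    IsTotallySingular (W ⊔ F ∙ p) := by
  intro r hr
  obtain ⟨w, hw, z, hz, rfl⟩ := Submodule.mem_sup.1 hr
  obtain ⟨t, rfl⟩ := Submodule.mem_span_singleton.1 hz
  have hwp : hyperbolicPolar F d w p = 0 := hp w hw
  rw [hyperbolicForm_add, hyperbolicForm_smul, h0, hW w hw, map_smul, hwp]
  simp

/-- Otherwise `w` is orthogonal to `U + Fa = A`, and `A` is its own orthogonal complement. -/
theorem not_polar_eq_zero (hA : IsTotallySingular A) (hAd : finrank F A = d) (hUA : U ≤ A)
    (hU : finrank F U + 1 = d) {a w : (Fin d → F) × (Fin d → F)} (ha : a ∈ A) (haU : a ∉ U)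
    (hw : w ∈ polarOrthogonal U) (hwA : w ∉ A) : hyperbolicPolar F d a w ≠ 0 := by
  intro h
  apply hwA
  rw [← hA.orthogonal_eq hAd, LinearMap.BilinForm.mem_orthogonal_iff,
    ← Submodule.sup_span_eq_of_finrank_succ hUA (hAd.trans hU.symm) ha haU]
  intro r hr
  obtain ⟨u, hu, z, hz, rfl⟩ := Submodule.mem_sup.1 hr
  obtain ⟨t, rfl⟩ := Submodule.mem_span_singleton.1 hz
  have huw : hyperbolicPolar F d u w = 0 := hw u hu
  simp [huw, h]

theorem exists_ne (hA : IsTotallySingular A) (hAd : finrank F A = d) (hUA : U ≤ A)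
    (hU : finrank F U + 1 = d) :
    ∃ B, IsTotallySingular B ∧ finrank F B = d ∧ B ≠ A ∧ U ≤ B := by
  have hUo := finrank_polarOrthogonal_add U
  have hlt : ¬ polarOrthogonal U ≤ A := fun h => by
    have := Submodule.finrank_mono h
    omega
  obtain ⟨w, hw, hwA⟩ := SetLike.not_le_iff_exists.1 hlt
  have hlt : ¬ A ≤ U := fun h => by
    have := Submodule.finrank_mono h
    omega
  obtain ⟨a, ha, haU⟩ := SetLike.not_le_iff_exists.1 hlt
  have h0 := hA.not_polar_eq_zero hAd hUA hU ha haU hw hwA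
  -- The form at `w + t • a` equals its value at `w` plus `t` times the polar value of `a` and `w`;
  -- this `t` makes it vanish.
  set t := -(hyperbolicForm F d w / hyperbolicPolar F d a w) with ht
  have hbA : w + t • a ∉ A := fun h => hwA ((A.add_mem_iff_left (A.smul_mem t ha)).1 h)
  have haUo : a ∈ polarOrthogonal U := fun u hu => hA.polar_eq_zero (hUA hu) ha
  have hb : w + t • a ∈ polarOrthogonal U :=
    (polarOrthogonal U).add_mem hw ((polarOrthogonal U).smul_mem t haUo)
  have hQ : hyperbolicForm F d (w + t • a) = 0 := by
    rw [hyperbolicForm_add, hyperbolicForm_smul, hA a ha, map_smul, hyperbolicPolar_comm w a, ht,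
      smul_eq_mul]
    field_simp
    ring
  refine ⟨U ⊔ F ∙ (w + t • a), (hA.mono hUA).sup_span hb hQ, ?_, ?_, le_sup_left⟩
  · rw [Submodule.finrank_sup_span_singleton fun h => hbA (hUA h), hU]
  · intro h
    exact hbA (h ▸ Submodule.mem_sup_right (Submodule.mem_span_singleton_self _))

/-- Writing a vector of `U^⊥ = A + Fb` as `a + tb`, the form equals `t` times the polar value of `a`
and `b`, so `t = 0` or `a ∈ U`. -/
theorem mem_or_mem (hA : IsTotallySingular A) (hB : IsTotallySingular B) (hAd : finrank F A = d)
    (hBd : finrank F B = d) (hAB : A ≠ B) (hUA : U ≤ A) (hUB : U ≤ B) (hU : finrank F U + 1 = d)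
    {x : (Fin d → F) × (Fin d → F)} (hx : x ∈ polarOrthogonal U) (h0 : hyperbolicForm F d x = 0) :
    x ∈ A ∨ x ∈ B := by
  have hne : ¬ B ≤ A := fun h =>
    hAB (Submodule.eq_of_le_of_finrank_eq h (hBd.trans hAd.symm)).symm
  obtain ⟨b, hb, hbA⟩ := SetLike.not_le_iff_exists.1 hne
  have hbU : b ∈ polarOrthogonal U := fun u hu => hB.polar_eq_zero (hUB hu) hb
  have hAU : A ≤ polarOrthogonal U := fun a ha u hu => hA.polar_eq_zero (hUA hu) ha
  have hsup : A ⊔ F ∙ b = polarOrthogonal U := by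
    refine Submodule.sup_span_eq_of_finrank_succ hAU ?_ hbU hbA
    have := finrank_polarOrthogonal_add U
    omega
  rw [← hsup] at hx
  obtain ⟨a, ha, z, hz, rfl⟩ := Submodule.mem_sup.1 hx
  obtain ⟨t, rfl⟩ := Submodule.mem_span_singleton.1 hz
  rw [hyperbolicForm_add, hyperbolicForm_smul, hA a ha, hB b hb, map_smul, smul_eq_mul] at h0
  simp only [mul_zero, zero_add, mul_eq_zero] at h0
  rcases h0 with rfl | h0
  · left
    simpa using ha
  · right
    refine B.add_mem (hUB ?_) (B.smul_mem t hb)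
    by_contra haU
    exact hA.not_polar_eq_zero hAd hUA hU ha haU hbU hbA h0

theorem inf_le_iff_not (hA : IsTotallySingular A) (hB : IsTotallySingular B)
    (hX : IsTotallySingular X) (hAd : finrank F A = d) (hBd : finrank F B = d)
    (hXd : finrank F X = d) (hAB : A ≠ B) (hUA : U ≤ A) (hUB : U ≤ B)
    (hU : finrank F U + 1 = d) : A ⊓ X ≤ U ↔ ¬ B ⊓ X ≤ U := by
  constructor
  · intro hAX hBX
    -- If neither `A` nor `B` meets `X` outside `U`, then `(U + X)^⊥ ≤ U ∩ X`, whereas its dimension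
    -- is `dim (U ∩ X) + 1`.
    have hinf : polarOrthogonal (U ⊔ X) ≤ U := by
      intro x hx
      have hxU : x ∈ polarOrthogonal U := fun u hu => hx u (Submodule.mem_sup_left hu)
      have hxX : x ∈ X := by
        rw [← hX.orthogonal_eq hXd]
        exact fun u hu => hx u (Submodule.mem_sup_right hu)
      rcases hA.mem_or_mem hB hAd hBd hAB hUA hUB hU hxU (hX x hxX) with h | h
      · exact hAX ⟨h, hxX⟩
      · exact hBX ⟨h, hxX⟩
    have hinf' : polarOrthogonal (U ⊔ X) ≤ X := fun x hx => by
      rw [← hX.orthogonal_eq hXd]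
      exact fun u hu => hx u (Submodule.mem_sup_right hu)
    have h1 := Submodule.finrank_mono (le_inf hinf hinf')
    have h2 := Submodule.finrank_sup_add_finrank_inf_eq U X
    have h3 := finrank_polarOrthogonal_add (U ⊔ X)
    omega
  · intro hBX
    by_contra hAX
    obtain ⟨a, ⟨haA, haX⟩, haU⟩ := SetLike.not_le_iff_exists.1 hAX
    obtain ⟨b, ⟨hbB, hbX⟩, hbU⟩ := SetLike.not_le_iff_exists.1 hBX
    have hbA : b ∉ A := by
      intro hbA
      apply hAB
      rw [← Submodule.sup_span_eq_of_finrank_succ hUA (hAd.trans hU.symm) hbA hbU,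
        Submodule.sup_span_eq_of_finrank_succ hUB (hBd.trans hU.symm) hbB hbU]
    -- Both `a` and `b` lie in the totally singular `X`, so their polar value is zero.
    exact hA.not_polar_eq_zero hAd hUA hU haA haU (fun u hu => hB.polar_eq_zero (hUB hu) hbB) hbA
      (hX.polar_eq_zero haX hbX)

end IsTotallySingular

/-- A vertex of the dual polar graph as a vertex of the Grassmann graph. -/
def DualPolarVertex.toGrassmann (A : DualPolarVertex F d) :
    GrassmannVertex F ((Fin d → F) × (Fin d → F)) d := ⟨A.1, A.2.1⟩

theorem DualPolarVertex.isThinFamily :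
    IsThinFamily (DualPolarVertex.toGrassmann : DualPolarVertex F d → _) where
  injective A B h := Subtype.ext
    (congrArg (fun W : GrassmannVertex F ((Fin d → F) × (Fin d → F)) d => W.1) h)
  exists_other A U hU hUA := by
    obtain ⟨B, hB, hBd, hBA, hUB⟩ := IsTotallySingular.exists_ne A.2.2 A.2.1 hUA hU
    exact ⟨⟨B, hBd, hB⟩, fun h => hBA (congrArg Subtype.val h), hUB⟩
  gate A B X U hAB hU hUA hUB :=
    IsTotallySingular.inf_le_iff_not A.2.2 B.2.2 X.2.2 A.2.1 B.2.1 X.2.1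
      (fun h => hAB (Subtype.ext h)) hUA hUB hU

instance : Nonempty (DualPolarVertex F d) :=
  ⟨⟨LinearMap.range (LinearMap.inl F (Fin d → F) (Fin d → F)), by
    rw [LinearMap.finrank_range_of_inj LinearMap.inl_injective, finrank_fin_fun], by
    rintro _ ⟨x, rfl⟩
    simp [hyperbolicForm]⟩⟩

theorem dualPolarGraph_eq_comap : dualPolarGraph F d =
    (grassmannGraph F ((Fin d → F) × (Fin d → F)) d).comap DualPolarVertex.toGrassmann := by
  ext A B
  refine and_congr_left fun _ => not_congr ?_
  exact (DualPolarVertex.isThinFamily.injective.eq_iff (a := A) (b := B)).symm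

theorem dualPolarGraph_isDistanceRegularWith [Finite F] :
    IsDistanceRegularWith (dualPolarGraph F d) d
      (fun i => gaussNum (Nat.card F) d - gaussNum (Nat.card F) i)
      (fun i => gaussNum (Nat.card F) i) := by
  rw [dualPolarGraph_eq_comap]
  exact DualPolarVertex.isThinFamily.isDistanceRegularWith

end DualPolarSpace

/-! ### The main theorem. -/

theorem theorem2 {F V : Type*} [Field F] [Finite F] [AddCommGroup V] [Module F V]
    (q n d : ℕ) (hq : Nat.card F = q) (hn : Module.finrank F V = n)
    (hd : 1 ≤ d) (hnd : 2 * d ≤ n) :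
    -- the minimum cardinality of a bitrade
    IsLeast {N : ℕ | ∃ T₀ T₁ : Set (GrassmannVertex F V d),
        IsSteinerBitrade F V d T₀ T₁ ∧ (T₀ ∪ T₁).ncard = N}
      (∏ i ∈ Finset.Icc 1 d, (q ^ (d - i) + 1)) ∧
    -- the identity
    ∏ i ∈ Finset.Icc 1 d, ((q : ℝ) ^ (d - i) + 1) =
      ∑ i ∈ Finset.range (d + 1), (q : ℝ) ^ (i.choose 2) * gaussBinom q d i ∧
    -- the value of the weight-distribution bound
    (∃ (D : ℕ) (b c : ℕ → ℕ) (k s : ℕ),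
      IsDistanceRegularWith (grassmannGraph F V d) D b c ∧
      IsCliquePair (grassmannGraph F V d) (steinerCliques F V d) k s 1 ∧
      (∀ T₀ T₁ : Set (GrassmannVertex F V d), IsSteinerBitrade F V d T₀ T₁ →
        IsEigenfunction (grassmannGraph F V d) (bitradeFun T₀ T₁) (-(k : ℝ) / s)) ∧
      wdBound D b c (-(k : ℝ) / s) = ∏ i ∈ Finset.Icc 1 d, ((q : ℝ) ^ (d - i) + 1)) ∧
    -- the subgraph generated by a minimum bitrade
    (∃ (D : ℕ) (b c : ℕ → ℕ),
      IsDistanceRegularWith (dualPolarGraph F d) D b c ∧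
      ∀ T₀ T₁ : Set (GrassmannVertex F V d), IsMinimumSteinerBitrade F V d T₀ T₁ →
        ((grassmannGraph F V d).induce (T₀ ∪ T₁)).IsBipartiteWith
          (Subtype.val ⁻¹' T₀) (Subtype.val ⁻¹' T₁) ∧
        IsDistanceRegularWith ((grassmannGraph F V d).induce (T₀ ∪ T₁)) D b c) := by
  -- An infinite-dimensional space has `finrank` zero, which `n ≥ 2d > 0` excludes.
  have hV : FiniteDimensional F V := Module.finite_of_finrank_pos (by omega)
  subst hq hn
  have hq2 : 2 ≤ Nat.card F := Finite.one_lt_card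
  obtain ⟨f, hf⟩ := (finrank_le_iff_exists_linearMap (R := F)
    (M := (Fin d → F) × (Fin d → F)) (M' := V)).1 (by simpa [two_mul] using hnd)
  have hthin : IsThinFamily (fun A : DualPolarVertex F d => (⟨A.1.map f,
      (Submodule.equivMapOfInjective f hf A.1).finrank_eq.symm.trans A.2.1⟩ :
        GrassmannVertex F V d)) :=
    DualPolarVertex.isThinFamily.map f hf fun _ => rfl
  obtain ⟨R₀, R₁, hR, hRcard⟩ := hthin.exists_isSteinerBitrade hd
  have hs : ((gaussNum (Nat.card F) (Module.finrank F V + 1 - d) - 1 : ℕ) : ℝ) ≠ 0 := by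
    have h := gaussNum_strictMono hq2 (show 1 < Module.finrank F V + 1 - d by omega)
    rw [gaussNum_one] at h
    exact_mod_cast (Nat.sub_pos_of_lt h).ne'
  have hθ : -((gaussNum (Nat.card F) d *
      (gaussNum (Nat.card F) (Module.finrank F V + 1 - d) - 1) : ℕ) : ℝ) /
      ((gaussNum (Nat.card F) (Module.finrank F V + 1 - d) - 1 : ℕ) : ℝ) =
      -gaussNum (Nat.card F) d := by
    rw [Nat.cast_mul, neg_div, mul_div_cancel_right₀ _ hs]
  rw [prod_Icc_pow_add_one, prod_Icc_pow_add_one]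
  refine ⟨⟨⟨R₀, R₁, hR, hRcard⟩, ?_⟩, prod_range_pow_add_one hq2 d,
    ⟨d, _, _, _, _, grassmannGraph_isDistanceRegularWith hnd, grassmannGraph_isCliquePair hnd,
      ?_, ?_⟩, ⟨d, _, _, dualPolarGraph_isDistanceRegularWith, ?_⟩⟩
  · rintro _ ⟨T₀, T₁, hT, rfl⟩
    exact hT.le_ncard
  · intro T₀ T₁ hT
    rw [hθ]
    exact hT.isEigenfunction
  · rw [hθ]
    exact wdBound_eq hq2 hnd
  · rintro T₀ T₁ ⟨hT, hmin⟩
    -- Comparison with the bitrade built from the dual polar graph shows that a minimum bitrade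
    -- attains the bound.
    have hcard := ((hmin R₀ R₁ hR).trans hRcard.le).antisymm hT.le_ncard
    obtain ⟨x, hx⟩ := hT.nonempty_left
    have : Nonempty ↥(T₀ ∪ T₁) := ⟨⟨x, .inl hx⟩⟩
    exact ⟨hT.isBipartiteWith, (hT.isThinFamily hcard).isDistanceRegularWith⟩
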